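/- Let $d \ge 1$ be an integer and let $\mathbb{T}^d = \mathbb{R}^d/\mathbb{Z}^d$ be the flat torus with normalized volume $\mathrm{Vol}$, $\mathrm{Vol}(\mathbb{T}^d)=1$. For an integer $T \ge 1$, the harmonic ensemble $X = X(T,\mathbb{T}^d)$ is the determinantal point process on $\mathbb{T}^d$ with kernel \[ K(x,y) = \sum_{k \in \mathbb{Z}^d,\ \|k\|_\infty \le T} e^{2 \pi i \langle k, x-y \rangle}, \] that is, the simple point process whose joint intensities with respect to $\mathrm{Vol}$ are $\rho_m(x_1,\ldots,x_m) = \det (K(x_i,x_j))_{i,j=1}^m$, $m = 1,2,\ldots$. It has almost surely exactly $N = (2T+1)^d$ points, $X = \{X_1, \ldots, X_N\}$. For $x, y \in \mathbb{T}^d$ let $[x,y]_{\mathrm{per}} = \prod_{j=1}^d [x_j,y_j]_{\mathrm{per}}$, where $[x_j,y_j]_{\mathrm{per}}$ is the closed arc of the circle $\mathbb{R}/\mathbb{Z}$ leading counterclockwise from $x_j$ to $y_j$. The periodic $L^2$ discrepancy of a finite set $A \subset \mathbb{T}^d$ with $|A| \ge 1$ points is \[ D_{\mathrm{per},2}(A)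 = \left( \int_{\mathbb{T}^d} \int_{\mathbb{T}^d} \left| \frac{|A \cap [x,y]_{\mathrm{per}}|}{|A|} - \mathrm{Vol}([x,y]_{\mathrm{per}}) \right|^2 \, \mathrm{d}\mathrm{Vol}(x) \, \mathrm{d}\mathrm{Vol}(y) \right)^{1/2} . \] Theorem. Let $\gamma$ be Euler's constant. The random variable $D_{\mathrm{per},2}^2(X)$ is integrable, and for every $d \ge 1$ and $T \ge 1$, \[ \mathbb{E} D_{\mathrm{per},2}^2 (X) = \frac{\log N + (\gamma+1) d}{2^{d-1} \pi^2 N^{1+\frac{1}{d}}} + O \left( \frac{(\log N)^2}{N^{1+\frac{2}{d}}} \right) \] with an implied constant depending only on $d$. In particular, for every fixed $d \ge 1$, as $T \to \infty$, \[ \sqrt{\mathbb{E} D_{\mathrm{per},2}^2 (X)} \sim \frac{1}{2^{\frac{d-1}{2}} \pi} \cdot \frac{(\log N)^{\frac{1}{2}}}{N^{\frac{1}{2} + \frac{1}{2d}}} . \] -/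

import Mathlib

open MeasureTheory Filter Asymptotics
open scoped ENNReal

noncomputable section

namespace TorusHarmonic

/-- A simple point process on `M` with finitely many points: a random finite subset of `M` such that
the number of points in every measurable set is a random variable. -/
def IsSimplePointProcess {M Ω : Type*} [MeasurableSpace M] [MeasurableSpace Ω]
    (X : Ω → Finset M) : Prop :=
  ∀ B : Set M, MeasurableSet B → Measurable fun ω => ((X ω : Set M) ∩ B).ncard

/-- The ordered `k`-tuples of pairwise distinct points of `A` that lie in `B`. -/
def distinctTuples {M : Type*} (k : ℕ) (A : Finset M) (B : Set (Fin k → M)) : Set (Fin k → M) :=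
  {a | Function.Injective a ∧ (∀ i, a i ∈ A) ∧ a ∈ B}

/-- `ρ` is the `k`-point joint intensity (correlation function) of `X` with respect to `μ`: the
expected number of `k`-tuples of distinct points of `X` in `B` is the integral of `ρ` over `B`. -/
def HasJointIntensity {M Ω : Type*} [MeasurableSpace M] [MeasurableSpace Ω]
    (μ : Measure M) (P : Measure Ω) (X : Ω → Finset M) (k : ℕ) (ρ : (Fin k → M) → ℝ≥0∞) : Prop :=
  ∀ B : Set (Fin k → M), MeasurableSet B →
    ∫⁻ ω, ((distinctTuples k (X ω) B).ncard : ℝ≥0∞) ∂P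
      = ∫⁻ x in B, ρ x ∂(Measure.pi fun _ : Fin k => μ)

/-- `X` is a determinantal point process with the Hermitian positive semidefinite kernel `K`:
a simple point process whose joint intensities are `det (K (x i) (x j))` (real and nonnegative). -/
structure IsDeterminantalProcess {M Ω : Type*} [MeasurableSpace M] [MeasurableSpace Ω]
    (μ : Measure M) (P : Measure Ω) (X : Ω → Finset M) (K : M → M → ℂ) : Prop where
  simple : IsSimplePointProcess X
  jointIntensity : ∀ k : ℕ, HasJointIntensity μ P X k fun x =>
    ENNReal.ofReal (Matrix.det (Matrix.of fun i j : Fin k => K (x i) (x j))).re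

/-- The flat torus `ℝ^d / ℤ^d`, with its normalized volume. -/
abbrev Torus (d : ℕ) : Type := UnitAddTorus (Fin d)

/-- The kernel `K(x,y) = ∑_{‖k‖_∞ ≤ T} exp (2 π i ⟨k, x - y⟩)`. -/
def harmonicKernel (d T : ℕ) (x y : Torus d) : ℂ :=
  ∑ k ∈ Fintype.piFinset fun _ : Fin d => Finset.Icc (-(T : ℤ)) (T : ℤ),
    UnitAddTorus.mFourier k (x - y)

/-- `X` is the harmonic ensemble on the torus with parameter `T`. -/
def IsHarmonicEnsemble {Ω : Type*} [MeasurableSpace Ω] (d T : ℕ)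
    (P : Measure Ω) (X : Ω → Finset (Torus d)) : Prop :=
  IsDeterminantalProcess volume P X (harmonicKernel d T)

/-- The periodic axis-parallel box: the product of the closed arcs that lead counterclockwise from
`x j` to `y j`. -/
def periodicBox {d : ℕ} (x y : Torus d) : Set (Torus d) :=
  Set.univ.pi fun j => Set.cIcc (x j) (y j)

/-- The periodic `L²` discrepancy of a finite point set. -/
def periodicDiscrepancy {d : ℕ} (A : Finset (Torus d)) : ℝ :=
  √(∫ x : Torus d, ∫ y : Torus d,
    |(((A : Set (Torus d)) ∩ periodicBox x y).ncard : ℝ) / (A.card : ℝ)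
      - volume.real (periodicBox x y)| ^ 2)

end TorusHarmonic

end

/-!
The mean square discrepancy of the harmonic ensemble can be computed exactly, and its asymptotics
are then those of a tail of `ζ(2)` and of a harmonic sum.

For a set `A` of `N` points, expand the square in the discrepancy and integrate over the box first.
A random arc of the circle contains two given points at relative position `t ∈ [0, 1)` with
probability `1/2 - t (1 - t)` (`arcKernel`); boxes are products of arcs, so that
`D² = N⁻² ∑_{a, b ∈ A} g (b - a) - 3⁻ᵈ` with `g` the product of `arcKernel` over the coordinates
(`periodicDiscrepancy_sq`). The terms involving the volume of the box are constants.

The expectation of a pair sum is determined by the first two joint intensities (`lintegral_pair_sum`),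
which for the harmonic ensemble are `N` and `N² - |K|²`. Applied to the constant function `1`, this
shows that the number of points has variance zero, because `∫ |K|² = N`
(`IsHarmonicEnsemble.ae_card_eq`). Applied to `g`, it gives
`E D² = N⁻² (N 2⁻ᵈ - ∫ g |K|²)`, where `|K|²` is a product of squared Dirichlet kernels and the
integral is the `d`-th power of a one-dimensional integral `J`
(`IsHarmonicEnsemble.integral_discrepancy_sq`).

Since `arcKernel` is a Bernoulli polynomial up to a constant, its Fourier coefficients are explicit,
and with `n = 2T + 1`, `N = n ^ d`,
`n/2 - J = π⁻² (n ∑_{m ≥ n} 1/m² + ∑_{m < n} 1/m) = π⁻² (log n + γ + 1 + O(1/n))`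
(`abs_circleDefect_sub_le`). Expanding `(n/2)^d - J^d` to first order in `n/2 - J` yields the theorem,
the quadratic remainder being responsible for the error term `(log N)²`.
-/

noncomputable section

namespace TorusHarmonic

/-! ### Arcs on the circle -/

instance : IsProbabilityMeasure (volume : Measure UnitAddCircle) :=
  ⟨UnitAddCircle.measure_univ⟩

/-- The representative in `[0, 1)` of a point of the circle. -/
def icoRep (z : UnitAddCircle) : ℝ := AddCircle.equivIco 1 0 z

lemma icoRep_nonneg (z : UnitAddCircle) : 0 ≤ icoRep z := (AddCircle.equivIco 1 0 z).2.1

lemma icoRep_lt_one (z : UnitAddCircle) : icoRep z < 1 := by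
  have h : ((AddCircle.equivIco (1 : ℝ) 0 z : Set.Ico (0 : ℝ) (0 + 1)) : ℝ) < 0 + 1 :=
    (AddCircle.equivIco 1 0 z).2.2
  exact h.trans_eq (zero_add 1)

lemma coe_icoRep (z : UnitAddCircle) : (icoRep z : UnitAddCircle) = z :=
  AddCircle.coe_equivIco

lemma icoRep_coe {u : ℝ} (hu : u ∈ Set.Ico (0 : ℝ) 1) : icoRep (u : UnitAddCircle) = u := by
  have h := AddCircle.equivIco_coe_of_mem (p := (1 : ℝ)) (a := 0) (y := u) (by simpa using hu)
  exact h

lemma measurable_icoRep : Measurable icoRep :=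
  measurable_subtype_coe.comp (AddCircle.measurableEquivIco (T := 1) 0).measurable

lemma integral_circle (f : UnitAddCircle → ℝ) : ∫ z, f z = ∫ u in (0 : ℝ)..1, f u := by
  have := UnitAddCircle.intervalIntegral_preimage 0 f
  rw [zero_add] at this
  exact this.symm

lemma intervalIntegral_congr_Ico {f g : ℝ → ℝ} {a b : ℝ} (hab : a ≤ b)
    (h : ∀ u ∈ Set.Ico a b, f u = g u) : ∫ u in a..b, f u = ∫ u in a..b, g u := by
  rw [intervalIntegral.integral_of_le hab, intervalIntegral.integral_of_le hab,
    ← integral_Ico_eq_integral_Ioc, ← integral_Ico_eq_integral_Ioc]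
  exact setIntegral_congr_fun measurableSet_Ico h

lemma integral_comp_icoRep (φ : ℝ → ℝ) : ∫ z, φ (icoRep z) = ∫ u in (0 : ℝ)..1, φ u := by
  rw [integral_circle]
  exact intervalIntegral_congr_Ico zero_le_one fun u hu => by rw [icoRep_coe hu]

/-- Away from the degenerate case `x = y`, in which `Set.cIcc x y` is the whole circle, the arc is
described by the representatives in `[0, 1)`. -/
lemma mem_cIcc_iff {x y : UnitAddCircle} (h : y ≠ x) (z : UnitAddCircle) :
    z ∈ Set.cIcc x y ↔ icoRep (z - x) ≤ icoRep (y - x) := by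
  -- `Btw.btw` on the circle compares the representative in `[0, 1)` of `z - x` with the
  -- representative in `(0, 1]` of `y - x`; these two kinds of representatives differ only at `0`.
  have key : ((AddCircle.equivIoc (1 : ℝ) 0 (y - x) : Set.Ioc (0 : ℝ) (0 + 1)) : ℝ)
      = icoRep (y - x) := by
    have h0 : icoRep (y - x) ≠ 0 := by
      intro h0
      apply h
      have := coe_icoRep (y - x)
      rw [h0] at this
      rw [← sub_eq_zero, ← this]
      rfl
    have hm : icoRep (y - x) ∈ Set.Ioc (0 : ℝ) (0 + 1) :=
      ⟨lt_of_le_of_ne (icoRep_nonneg _) (Ne.symm h0), by simpa using (icoRep_lt_one _).le⟩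
    have := AddCircle.equivIoc_coe_of_mem (p := (1 : ℝ)) (a := 0) hm
    rw [coe_icoRep] at this
    exact this
  rw [← key]
  exact Iff.rfl

lemma ae_ne_circle (x : UnitAddCircle) : ∀ᵐ y : UnitAddCircle, y ≠ x := by
  have h : (volume : Measure UnitAddCircle) {x} = 0 := by
    have := UnitAddCircle.lintegral_preimage 0 (Set.indicator {x} 1)
    rw [lintegral_indicator_one (measurableSet_singleton x)] at this
    rw [← this, zero_add]
    rw [← lintegral_zero (μ := volume.restrict (Set.Ioc (0 : ℝ) 1)),
      ← restrict_Ico_eq_restrict_Ioc]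
    refine lintegral_congr_ae ?_
    have h1 : ∀ᵐ u : ℝ ∂(volume.restrict (Set.Ico (0 : ℝ) 1)), u ≠ icoRep x :=
      ae_restrict_of_ae (by simp [ae_iff])
    filter_upwards [h1, ae_restrict_mem measurableSet_Ico] with u hu hm
    rw [Set.indicator_of_notMem]
    rintro rfl
    exact hu (icoRep_coe hm).symm
  simpa [ae_iff] using h

lemma volume_real_cIcc {x y : UnitAddCircle} (h : y ≠ x) :
    volume.real (Set.cIcc x y) = icoRep (y - x) := by
  have hset : Set.cIcc x y = {z | icoRep (z - x) ≤ icoRep (y - x)} :=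
    Set.ext fun z => mem_cIcc_iff h z
  have hm : MeasurableSet {z : UnitAddCircle | icoRep (z - x) ≤ icoRep (y - x)} :=
    measurableSet_le (measurable_icoRep.comp (measurable_sub_const x)) measurable_const
  rw [hset, ← integral_indicator_one hm]
  have h0 := icoRep_nonneg (y - x)
  have h1 := icoRep_lt_one (y - x)
  set t := icoRep (y - x)
  calc ∫ z, Set.indicator {z : UnitAddCircle | icoRep (z - x) ≤ t} 1 z
      = ∫ z, (Set.indicator (Set.Iic t) (1 : ℝ → ℝ)) (icoRep (z - x)) := by rfl
    _ = ∫ z, (Set.indicator (Set.Iic t) (1 : ℝ → ℝ)) (icoRep z) :=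
        integral_sub_right_eq_self (fun z => (Set.indicator (Set.Iic t) (1 : ℝ → ℝ)) (icoRep z)) x
    _ = ∫ u in (0 : ℝ)..1, Set.indicator (Set.Iic t) (1 : ℝ → ℝ) u := integral_comp_icoRep _
    _ = ∫ u in (0 : ℝ)..t, (1 : ℝ → ℝ) u :=
        intervalIntegral.integral_indicator ⟨h0, h1.le⟩
    _ = t := by simp

/-- The indicator of the event that `a` lies on the arc from `x` to `y`. -/
def arcInd (a x y : UnitAddCircle) : ℝ := (Set.cIcc x y).indicator 1 a

lemma arcInd_eq {x y : UnitAddCircle} (h : y ≠ x) (a : UnitAddCircle) :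
    arcInd a x y = (Set.Ici (icoRep (a - x))).indicator 1 (icoRep (y - x)) := by
  unfold arcInd
  by_cases hm : a ∈ Set.cIcc x y
  · rw [Set.indicator_of_mem hm, Set.indicator_of_mem (by simpa using (mem_cIcc_iff h a).1 hm)]
    rfl
  · rw [Set.indicator_of_notMem hm,
      Set.indicator_of_notMem (by simpa using fun h' => hm ((mem_cIcc_iff h a).2 h'))]

/-! ### Iterated integrals of products -/

/-- The iterated integral `∫ x, ∫ y, f x y` exists, with the inner integrand integrable for every `x`,
and is equal to `c`. Joint measurability of `f` is not part of the notion. -/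
structure HasIteratedIntegral {M : Type*} [MeasureSpace M] (f : M → M → ℝ) (c : ℝ) : Prop where
  inner : ∀ x, Integrable (f x)
  outer : Integrable fun x => ∫ y, f x y
  integral_eq : ∫ x, ∫ y, f x y = c

namespace HasIteratedIntegral

variable {M : Type*} [MeasureSpace M] {f g : M → M → ℝ} {c e : ℝ}

lemma add (hf : HasIteratedIntegral f c) (hg : HasIteratedIntegral g e) :
    HasIteratedIntegral (fun x y => f x y + g x y) (c + e) := by
  have h : (fun x => ∫ y, f x y + g x y) = fun x => (∫ y, f x y) + ∫ y, g x y :=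
    funext fun x => integral_add (hf.inner x) (hg.inner x)
  refine ⟨fun x => (hf.inner x).add (hg.inner x), ?_, ?_⟩
  · rw [h]; exact hf.outer.add hg.outer
  · rw [h, integral_add hf.outer hg.outer, hf.integral_eq, hg.integral_eq]

lemma const_mul (hf : HasIteratedIntegral f c) (r : ℝ) :
    HasIteratedIntegral (fun x y => r * f x y) (r * c) := by
  have h : (fun x => ∫ y, r * f x y) = fun x => r * ∫ y, f x y :=
    funext fun x => integral_const_mul r _
  refine ⟨fun x => (hf.inner x).const_mul r, ?_, ?_⟩
  · rw [h]; exact hf.outer.const_mul r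
  · rw [h, integral_const_mul, hf.integral_eq]

lemma sum {ι : Type*} (s : Finset ι) {f : ι → M → M → ℝ} {c : ι → ℝ}
    (hf : ∀ i, HasIteratedIntegral (f i) (c i)) :
    HasIteratedIntegral (fun x y => ∑ i ∈ s, f i x y) (∑ i ∈ s, c i) := by
  have h : (fun x => ∫ y, ∑ i ∈ s, f i x y) = fun x => ∑ i ∈ s, ∫ y, f i x y :=
    funext fun x => integral_finsetSum s fun i _ => (hf i).inner x
  refine ⟨fun x => integrable_finsetSum s fun i _ => (hf i).inner x, ?_, ?_⟩
  · rw [h]; exact integrable_finsetSum s fun i _ => (hf i).outer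
  · rw [h, integral_finsetSum s fun i _ => (hf i).outer]
    exact Finset.sum_congr rfl fun i _ => (hf i).integral_eq

/-- Iterated integrals of product functions factor over the coordinates. -/
lemma pi [SigmaFinite (volume : Measure M)] {ι : Type*} [Fintype ι] {f : ι → M → M → ℝ} {c : ι → ℝ}
    (hf : ∀ i, HasIteratedIntegral (f i) (c i)) :
    HasIteratedIntegral (fun (x y : ι → M) => ∏ i, f i (x i) (y i)) (∏ i, c i) := by
  have h : (fun x : ι → M => ∫ y : ι → M, ∏ i, f i (x i) (y i))
      = fun x => ∏ i, ∫ y, f i (x i) y :=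
    funext fun x => integral_fintype_prod_volume_eq_prod (𝕜 := ℝ) fun i y => f i (x i) y
  refine ⟨fun x => Integrable.fintype_prod fun i => (hf i).inner (x i), ?_, ?_⟩
  · rw [h]
    exact Integrable.fintype_prod (f := fun i x => ∫ y, f i x y) fun i => (hf i).outer
  · rw [h, integral_fintype_prod_volume_eq_prod (𝕜 := ℝ) fun i x => ∫ y, f i x y]
    exact Finset.prod_congr rfl fun i _ => (hf i).integral_eq

end HasIteratedIntegral

/-- An iterated integral over the circle of a function that depends on `y` only through the position
`icoRep (y - x)` of `y` relative to `x`. -/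
lemma hasIteratedIntegral_circle {f : UnitAddCircle → UnitAddCircle → ℝ} {φ : UnitAddCircle → ℝ → ℝ}
    {F : UnitAddCircle → ℝ} {c K : ℝ} (hφ : ∀ x, Measurable (φ x))
    (hb : ∀ x, ∀ u ∈ Set.Ico (0 : ℝ) 1, |φ x u| ≤ K)
    (hf : ∀ x y, y ≠ x → f x y = φ x (icoRep (y - x)))
    (hF : ∀ x, ∫ u in (0 : ℝ)..1, φ x u = F x) (hFm : Measurable F) (hFb : ∀ x, |F x| ≤ K)
    (hc : ∫ x, F x = c) : HasIteratedIntegral f c := by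
  have hfae : ∀ x, f x =ᵐ[volume] fun y => φ x (icoRep (y - x)) := fun x => by
    filter_upwards [ae_ne_circle x] with y hy using hf x y hy
  have hin : ∀ x, ∫ y, f x y = F x := fun x => by
    rw [integral_congr_ae (hfae x), integral_sub_right_eq_self (fun z => φ x (icoRep z)) x,
      integral_comp_icoRep, hF]
  refine ⟨fun x => ?_, ?_, ?_⟩
  · refine Integrable.congr ?_ (hfae x).symm
    refine Integrable.of_bound (C := K)
      ((hφ x).comp (measurable_icoRep.comp (measurable_sub_const x))).aestronglyMeasurable ?_
    exact Eventually.of_forall fun y => hb x _ ⟨icoRep_nonneg _, icoRep_lt_one _⟩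
  · simp_rw [hin]
    exact Integrable.of_bound (C := K) hFm.aestronglyMeasurable (Eventually.of_forall hFb)
  · simp_rw [hin]; exact hc

lemma integral_indicator_Ici {s : ℝ} (hs : s ∈ Set.Ico (0 : ℝ) 1) {φ : ℝ → ℝ}
    (hφ : Continuous φ) :
    ∫ u in (0 : ℝ)..1, (Set.Ici s).indicator φ u = ∫ u in s..1, φ u := by
  rw [← intervalIntegral.integral_add_adjacent_intervals (b := s)]
  · have e1 : ∀ u ∈ Set.Ico (0 : ℝ) s, (Set.Ici s).indicator φ u = 0 := fun u hu =>
      Set.indicator_of_notMem (by simpa using hu.2) _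
    have e2 : ∀ u ∈ Set.Ico s 1, (Set.Ici s).indicator φ u = φ u := fun u hu =>
      Set.indicator_of_mem hu.1 _
    rw [intervalIntegral_congr_Ico hs.1 e1, intervalIntegral_congr_Ico hs.2.le e2]
    simp
  all_goals
    rw [intervalIntegrable_iff]
    exact ((hφ.intervalIntegrable _ _).def').indicator measurableSet_Ici

/-- The pair function `1/2 - t (1 - t)` of the circle, with `t ∈ [0, 1)` the relative position of the
two points: the probability that a random arc contains both of them. -/
def arcKernel (z : UnitAddCircle) : ℝ := 1 / 2 - icoRep z * (1 - icoRep z)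

lemma icoRep_add_of_lt {u t : ℝ} (hu : 0 ≤ u) (ht : 0 ≤ t) (h : u + t < 1) :
    icoRep ((u : UnitAddCircle) + (t : UnitAddCircle)) = u + t := by
  rw [← AddCircle.coe_add]
  exact icoRep_coe ⟨by linarith, h⟩

lemma icoRep_add_of_ge {u t : ℝ} (hu : u < 1) (ht : t < 1) (h : 1 ≤ u + t) :
    icoRep ((u : UnitAddCircle) + (t : UnitAddCircle)) = u + t - 1 := by
  have : ((u : UnitAddCircle) + (t : UnitAddCircle)) = ((u + t - 1 : ℝ) : UnitAddCircle) := by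
    rw [AddCircle.coe_sub, AddCircle.coe_period, sub_zero, AddCircle.coe_add]
  rw [this]
  exact icoRep_coe ⟨by linarith, by linarith⟩

/-- On `u < 1 - t` the two positions are `u` and `u + t`, and on `1 - t ≤ u` they are `u` and
`u + t - 1`; the two ranges contribute `(1 - t)² / 2` and `t² / 2`. -/
lemma integral_one_sub_max (w : UnitAddCircle) :
    ∫ x, (1 - max (icoRep x) (icoRep (x + w))) = arcKernel w := by
  have h0 := icoRep_nonneg w
  have h1 := icoRep_lt_one w
  unfold arcKernel
  rw [integral_circle]
  set t := icoRep w with ht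
  rw [← coe_icoRep w, ← ht]
  have e1 : ∀ u ∈ Set.Ico (0 : ℝ) (1 - t),
      1 - max (icoRep (u : UnitAddCircle)) (icoRep ((u : UnitAddCircle) + (t : UnitAddCircle)))
        = 1 - t - u := fun u hu => by
    rw [icoRep_add_of_lt hu.1 h0 (by linarith [hu.2]),
      icoRep_coe ⟨hu.1, by linarith [hu.2]⟩, max_eq_right (by linarith)]
    ring
  have e2 : ∀ u ∈ Set.Ico (1 - t) (1 : ℝ),
      1 - max (icoRep (u : UnitAddCircle)) (icoRep ((u : UnitAddCircle) + (t : UnitAddCircle)))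
        = 1 - u := fun u hu => by
    rw [icoRep_add_of_ge hu.2 h1 (by linarith [hu.1]),
      icoRep_coe ⟨by linarith [hu.1], hu.2⟩, max_eq_left (by linarith)]
  have hint : ∀ a b : ℝ, IntervalIntegrable (fun u : ℝ => 1 - max (icoRep (u : UnitAddCircle))
      (icoRep ((u : UnitAddCircle) + (t : UnitAddCircle)))) volume a b := fun a b => by
    rw [intervalIntegrable_iff]
    refine Measure.integrableOn_of_bounded (M := 1) (by simp) ?_ ?_
    · have hm : Measurable (fun u : ℝ => (u : UnitAddCircle)) := AddCircle.measurable_mk'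
      exact (measurable_const.sub ((measurable_icoRep.comp hm).max
        (measurable_icoRep.comp (hm.add_const _)))).aestronglyMeasurable
    · refine Eventually.of_forall fun u => ?_
      have a1 := icoRep_nonneg (u : UnitAddCircle)
      have a2 := icoRep_lt_one (u : UnitAddCircle)
      have a3 := icoRep_lt_one ((u : UnitAddCircle) + (t : UnitAddCircle))
      have a4 := le_max_left (icoRep (u : UnitAddCircle))
        (icoRep ((u : UnitAddCircle) + (t : UnitAddCircle)))
      have a5 := max_lt a2 a3
      rw [Real.norm_eq_abs, abs_le]
      constructor <;> linarith
  have hlin : ∀ c a b : ℝ, ∫ u in a..b, (c - u) = c * (b - a) - (b ^ 2 - a ^ 2) / 2 :=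
    fun c a b => by
      rw [intervalIntegral.integral_sub (by simp) (by simp), intervalIntegral.integral_const,
        integral_id, smul_eq_mul]
      ring
  rw [← intervalIntegral.integral_add_adjacent_intervals (hint 0 (1 - t)) (hint (1 - t) 1),
    intervalIntegral_congr_Ico (by linarith) e1, intervalIntegral_congr_Ico (by linarith) e2,
    hlin, hlin]
  ring

/-- Both `a` and `b` lie on the arc from `x` to `y` exactly if the position of `y` relative to `x` is
at least the maximum `m` of those of `a` and `b`, so that integrating over `y` gives `1 - m`. -/
lemma hasIteratedIntegral_arcInd_mul_arcInd (a b : UnitAddCircle) :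
    HasIteratedIntegral (fun x y => arcInd a x y * arcInd b x y) (arcKernel (b - a)) := by
  have hmem : ∀ x, max (icoRep (a - x)) (icoRep (b - x)) ∈ Set.Ico (0 : ℝ) 1 := fun x =>
    ⟨le_max_of_le_left (icoRep_nonneg _), max_lt (icoRep_lt_one _) (icoRep_lt_one _)⟩
  have hsub : ∀ a : UnitAddCircle, Measurable fun x => icoRep (a - x) := fun a =>
    measurable_icoRep.comp (measurable_const_sub a)
  refine hasIteratedIntegral_circle (K := 1)
    (φ := fun x => (Set.Ici (max (icoRep (a - x)) (icoRep (b - x)))).indicator 1)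
    (F := fun x => 1 - max (icoRep (a - x)) (icoRep (b - x)))
    (fun x => measurable_one.indicator measurableSet_Ici) ?_ ?_ ?_ ?_ ?_ ?_
  · intro x u _
    by_cases hu : u ∈ Set.Ici (max (icoRep (a - x)) (icoRep (b - x)))
    · simp [Set.indicator_of_mem hu]
    · simp [Set.indicator_of_notMem hu]
  · intro x y hxy
    rw [arcInd_eq hxy, arcInd_eq hxy, ← Set.Ici_inter_Ici, Set.inter_indicator_one]
    rfl
  · intro x
    rw [integral_indicator_Ici (hmem x) continuous_one]
    simp
  · exact measurable_const.sub ((hsub a).max (hsub b))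
  · intro x
    have := hmem x
    rw [abs_le]
    constructor <;> linarith [this.1, this.2]
  · rw [← integral_one_sub_max,
      ← integral_sub_left_eq_self (fun x => 1 - max (icoRep x) (icoRep (x + (b - a)))) volume a]
    refine integral_congr_ae (Eventually.of_forall fun x => ?_)
    simp only
    congr 3
    abel_nf

lemma hasIteratedIntegral_arcInd_mul_volume (a : UnitAddCircle) :
    HasIteratedIntegral (fun x y => arcInd a x y * volume.real (Set.cIcc x y)) (1 / 3) := by
  have hmem : ∀ x, icoRep (a - x) ∈ Set.Ico (0 : ℝ) 1 := fun x =>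
    ⟨icoRep_nonneg _, icoRep_lt_one _⟩
  refine hasIteratedIntegral_circle (K := 1)
    (φ := fun x => (Set.Ici (icoRep (a - x))).indicator id)
    (F := fun x => (1 - icoRep (a - x) ^ 2) / 2)
    (fun x => measurable_id.indicator measurableSet_Ici) ?_ ?_ ?_ ?_ ?_ ?_
  · intro x u hu'
    by_cases hu : u ∈ Set.Ici (icoRep (a - x))
    · simp only [Set.indicator_of_mem hu, id]
      rw [abs_of_nonneg hu'.1]
      exact hu'.2.le
    · simp [Set.indicator_of_notMem hu]
  · intro x y hxy
    rw [arcInd_eq hxy, volume_real_cIcc hxy]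
    by_cases hu : icoRep (y - x) ∈ Set.Ici (icoRep (a - x))
    · simp [Set.indicator_of_mem hu]
    · simp [Set.indicator_of_notMem hu]
  · intro x
    rw [integral_indicator_Ici (hmem x) continuous_id]
    simp
  · exact (measurable_const.sub
      ((measurable_icoRep.comp (measurable_const_sub a)).pow_const 2)).div_const 2
  · intro x
    have h1 := (hmem x).1
    have h2 := (hmem x).2
    rw [abs_le]
    constructor <;> nlinarith
  · rw [integral_sub_left_eq_self (fun x => (1 - icoRep x ^ 2) / 2) volume a,
      integral_comp_icoRep fun u => (1 - u ^ 2) / 2, intervalIntegral.integral_div,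
      intervalIntegral.integral_sub (by simp) (by simp)]
    simp only [intervalIntegral.integral_const, integral_pow]
    norm_num

lemma hasIteratedIntegral_volume_sq :
    HasIteratedIntegral (fun x y : UnitAddCircle => volume.real (Set.cIcc x y) ^ 2) (1 / 3) := by
  refine hasIteratedIntegral_circle (K := 1) (φ := fun _ u => u ^ 2) (F := fun _ => 1 / 3)
    (fun x => measurable_id.pow_const 2) ?_ ?_ ?_ measurable_const ?_ ?_
  · intro x u hu
    rw [abs_of_nonneg (sq_nonneg u)]
    nlinarith [hu.1, hu.2]
  · intro x y hxy
    rw [volume_real_cIcc hxy]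
  · intro x
    rw [integral_pow]
    norm_num
  · intro x
    norm_num [abs_of_pos]
  · rw [integral_const, probReal_univ]
    simp

/-! ### The discrepancy of a finite set as a pair sum -/

/-- The pair function `∏ j, (1/2 - t j (1 - t j))` of the torus. -/
def boxKernel {d : ℕ} (z : Torus d) : ℝ := ∏ j, arcKernel (z j)

lemma ncard_inter_periodicBox {d : ℕ} (A : Finset (Torus d)) (x y : Torus d) :
    (((A : Set (Torus d)) ∩ periodicBox x y).ncard : ℝ)
      = ∑ a ∈ A, ∏ j, arcInd (a j) (x j) (y j) := by
  classical
  have h : ∀ a : Torus d, ∏ j, arcInd (a j) (x j) (y j)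
      = if a ∈ periodicBox x y then 1 else 0 := by
    intro a
    split_ifs with ha
    · exact Finset.prod_eq_one fun j _ => Set.indicator_of_mem (ha j (Set.mem_univ j)) _
    · simp only [periodicBox, Set.mem_pi, Set.mem_univ, true_imp_iff, not_forall] at ha
      obtain ⟨j, hj⟩ := ha
      exact Finset.prod_eq_zero (Finset.mem_univ j) (Set.indicator_of_notMem hj _)
  have hset : (A : Set (Torus d)) ∩ periodicBox x y
      = ((A.filter (· ∈ periodicBox x y) : Finset (Torus d)) : Set (Torus d)) := by
    ext a; simp
  rw [hset, Set.ncard_coe_finset, Finset.sum_congr rfl fun a _ => h a, Finset.sum_boole]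

lemma volume_real_periodicBox {d : ℕ} (x y : Torus d) :
    volume.real (periodicBox x y) = ∏ j, volume.real (Set.cIcc (x j) (y j)) := by
  simp only [periodicBox, measureReal_def, volume_pi_pi, ENNReal.toReal_prod]

/-- Expanding the square in the discrepancy, all cross terms with the volume of the box integrate
to constants, and only the pair sum of `boxKernel` remains. -/
lemma periodicDiscrepancy_sq {d : ℕ} {A : Finset (Torus d)} {N : ℕ} (hN : N ≠ 0)
    (hA : A.card = N) :
    periodicDiscrepancy A ^ 2
      = (1 / (N : ℝ) ^ 2) * (∑ a ∈ A, ∑ b ∈ A, boxKernel (b - a)) - (1 / 3) ^ d := by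
  have hN' : (N : ℝ) ≠ 0 := by exact_mod_cast hN
  rw [periodicDiscrepancy, Real.sq_sqrt
    (integral_nonneg fun x => integral_nonneg fun y => sq_nonneg _)]
  have h1 : HasIteratedIntegral (fun x y : Torus d => ∑ a ∈ A, ∑ b ∈ A,
      ∏ j, (arcInd (a j) (x j) (y j) * arcInd (b j) (x j) (y j)))
      (∑ a ∈ A, ∑ b ∈ A, boxKernel (b - a)) :=
    .sum A fun a => .sum A fun b => .pi fun j => hasIteratedIntegral_arcInd_mul_arcInd (a j) (b j)
  have h2 : HasIteratedIntegral (fun x y : Torus d => ∑ a ∈ A,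
      ∏ j, (arcInd (a j) (x j) (y j) * volume.real (Set.cIcc (x j) (y j))))
      (∑ a ∈ A, ∏ _j : Fin d, (1 / 3 : ℝ)) :=
    .sum A fun a => .pi fun j => hasIteratedIntegral_arcInd_mul_volume (a j)
  have h3 : HasIteratedIntegral (fun x y : Torus d =>
      ∏ j, volume.real (Set.cIcc (x j) (y j)) ^ 2) (∏ _j : Fin d, (1 / 3 : ℝ)) :=
    .pi fun j => hasIteratedIntegral_volume_sq
  have h := ((h1.const_mul (1 / (N : ℝ) ^ 2)).add (h2.const_mul (-2 / N))).add h3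
  have hfun : ∀ x y : Torus d,
      |(((A : Set (Torus d)) ∩ periodicBox x y).ncard : ℝ) / (A.card : ℝ)
        - volume.real (periodicBox x y)| ^ 2
      = 1 / (N : ℝ) ^ 2 * (∑ a ∈ A, ∑ b ∈ A,
          ∏ j, (arcInd (a j) (x j) (y j) * arcInd (b j) (x j) (y j)))
        + -2 / N * (∑ a ∈ A, ∏ j, (arcInd (a j) (x j) (y j) * volume.real (Set.cIcc (x j) (y j))))
        + ∏ j, volume.real (Set.cIcc (x j) (y j)) ^ 2 := by
    intro x y
    rw [sq_abs, ncard_inter_periodicBox, volume_real_periodicBox, hA]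
    simp only [Finset.prod_mul_distrib, Finset.prod_pow, ← Finset.sum_mul, ← Finset.mul_sum]
    field_simp
    ring
  simp only [hfun]
  rw [h.integral_eq]
  simp only [Finset.prod_const, Finset.sum_const, Finset.card_univ, Fintype.card_fin, hA,
    nsmul_eq_mul]
  field_simp
  ring

/-! ### Pair statistics of point processes -/

section PointProcess

lemma ncard_distinctTuples_one {M : Type*} (A : Finset M) (B : Set M) :
    (distinctTuples 1 A {x | x 0 ∈ B}).ncard = ((A : Set M) ∩ B).ncard := by
  have h : distinctTuples 1 A {x | x 0 ∈ B}
      = (Equiv.funUnique (Fin 1) M).symm '' ((A : Set M) ∩ B) := by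
    ext x
    rw [Equiv.image_symm_eq_preimage]
    simp [distinctTuples, Function.injective_of_subsingleton]
  rw [h, Set.ncard_image_of_injective _ (Equiv.injective _)]

variable {M Ω : Type*} [MeasurableSpace M] [MeasurableSpace Ω]

/-- The counting measure of a finite set of points. -/
def pointMeasure (A : Finset M) : Measure M := ∑ a ∈ A, Measure.dirac a

lemma pointMeasure_apply (A : Finset M) {B : Set M} (hB : MeasurableSet B) :
    pointMeasure A B = (((A : Set M) ∩ B).ncard : ℝ≥0∞) := by
  classical
  have hset : (A : Set M) ∩ B = ((A.filter (· ∈ B) : Finset M) : Set M) := by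
    ext a; simp
  rw [hset, Set.ncard_coe_finset, pointMeasure, Measure.finsetSum_apply,
    Finset.sum_congr rfl fun a _ => Measure.dirac_apply' a hB, Finset.card_filter]
  simp [Set.indicator_apply]

instance (A : Finset M) : IsFiniteMeasure (pointMeasure A) :=
  ⟨by rw [pointMeasure_apply A MeasurableSet.univ]; exact ENNReal.natCast_lt_top _⟩

lemma lintegral_pointMeasure (A : Finset M) {g : M → ℝ≥0∞} (hg : Measurable g) :
    ∫⁻ a, g a ∂(pointMeasure A) = ∑ a ∈ A, g a := by
  rw [pointMeasure, lintegral_finsetSum_measure]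
  exact Finset.sum_congr rfl fun a _ => lintegral_dirac' a hg

lemma lintegral_pointMeasure_prod (A : Finset M) {g : M × M → ℝ≥0∞} (hg : Measurable g) :
    ∫⁻ p, g p ∂((pointMeasure A).prod (pointMeasure A)) = ∑ a ∈ A, ∑ b ∈ A, g (a, b) := by
  rw [lintegral_prod _ hg.aemeasurable, lintegral_pointMeasure A hg.lintegral_prod_right']
  exact Finset.sum_congr rfl fun a _ => lintegral_pointMeasure A (hg.comp measurable_prodMk_left)

variable {X : Ω → Finset M}

/-- Counts of the points in sets are random variables by assumption; a π-λ argument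
extends this to counts of the pairs of points in measurable subsets of `M × M`. -/
lemma IsSimplePointProcess.measurable_pointMeasure_prod (hX : IsSimplePointProcess X) :
    Measurable fun ω => (pointMeasure (X ω)).prod (pointMeasure (X ω)) := by
  have h1 : ∀ B : Set M, MeasurableSet B → Measurable fun ω => pointMeasure (X ω) B := by
    intro B hB
    simp only [pointMeasure_apply _ hB]
    exact measurable_from_top.comp (hX B hB)
  refine Measurable.measure_of_isPiSystem generateFrom_prod.symm isPiSystem_prod ?_ ?_
  · rintro _ ⟨s, hs, t, ht, rfl⟩
    simp only [Measure.prod_prod]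
    exact (h1 s hs).mul (h1 t ht)
  · simp only [← Set.univ_prod_univ, Measure.prod_prod]
    exact (h1 _ MeasurableSet.univ).mul (h1 _ MeasurableSet.univ)

lemma IsSimplePointProcess.measurable_pair_sum (hX : IsSimplePointProcess X)
    {g : M × M → ℝ≥0∞} (hg : Measurable g) :
    Measurable fun ω => ∑ a ∈ X ω, ∑ b ∈ X ω, g (a, b) := by
  simp only [← lintegral_pointMeasure_prod _ hg]
  exact (Measure.measurable_lintegral hg).comp hX.measurable_pointMeasure_prod

/-- The points of `A ×ˢ A` in `B` are the off-diagonal pairs, counted by `distinctTuples 2`, together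
with the diagonal pairs, counted by `distinctTuples 1`. -/
lemma pointMeasure_prod_apply (A : Finset M) {B : Set (M × M)} (hB : MeasurableSet B) :
    (pointMeasure A).prod (pointMeasure A) B
      = ((distinctTuples 2 A {x | (x 0, x 1) ∈ B}).ncard : ℝ≥0∞)
        + ((distinctTuples 1 A {x | (x 0, x 0) ∈ B}).ncard : ℝ≥0∞) := by
  classical
  have h2 : distinctTuples 2 A {x | (x 0, x 1) ∈ B}
      = (finTwoArrowEquiv M).symm ''
        (((A ×ˢ A).filter fun p => p ∈ B ∧ p.1 ≠ p.2 : Finset (M × M)) : Set (M × M)) := by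
    ext x
    rw [Equiv.image_symm_eq_preimage]
    simp only [distinctTuples, Set.mem_ofPred_eq, Set.mem_preimage, Finset.coe_filter,
      Finset.mem_product, finTwoArrowEquiv_apply, Fin.forall_fin_two]
    have : Function.Injective x ↔ x 0 ≠ x 1 := by
      constructor
      · intro h h'
        exact absurd (h h') (by decide)
      · intro h i j hij
        fin_cases i <;> fin_cases j <;> simp_all [eq_comm]
    rw [this]
    tauto
  have h1 : (distinctTuples 1 A {x | (x 0, x 0) ∈ B}).ncard
      = (A.filter fun a => (a, a) ∈ B).card := by
    rw [← Set.ncard_coe_finset, Finset.coe_filter]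
    exact ncard_distinctTuples_one A {a | (a, a) ∈ B}
  rw [h2, h1, Set.ncard_image_of_injective _ (Equiv.injective _), Set.ncard_coe_finset,
    ← lintegral_indicator_one hB, lintegral_pointMeasure_prod A (measurable_one.indicator hB),
    ← Finset.sum_product']
  have hd : A.filter (fun a => (a, a) ∈ B)
      = (((A ×ˢ A).filter fun p => p ∈ B ∧ ¬ p.1 ≠ p.2)).image Prod.fst := by
    ext a
    simp only [Finset.mem_filter, Finset.mem_image, Finset.mem_product, Prod.exists, not_not]
    constructor
    · rintro ⟨h, hb⟩; exact ⟨a, a, ⟨⟨h, h⟩, hb, rfl⟩, rfl⟩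
    · rintro ⟨_, _, ⟨⟨h, _⟩, hb, rfl⟩, rfl⟩; exact ⟨h, hb⟩
  rw [hd, Finset.card_image_of_injOn, ← Finset.filter_filter, ← Finset.filter_filter,
    ← Nat.cast_add, Finset.card_filter_add_card_filter_not, Finset.card_filter]
  · simp [Set.indicator_apply]
  · rintro ⟨a, b⟩ hp ⟨a', b'⟩ hp' h
    simp only [Finset.coe_filter, Set.mem_ofPred_eq, not_not] at hp hp' h
    obtain ⟨_, _, rfl⟩ := hp
    obtain ⟨_, _, rfl⟩ := hp'
    rw [h]

/-- The first two joint intensities determine the expectation of a sum over all pairs of points. -/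
lemma lintegral_pair_sum {μ : Measure M} [SigmaFinite μ] {P : Measure Ω}
    (hX : IsSimplePointProcess X) {ρ₁ : M → ℝ≥0∞} {ρ₂ : M × M → ℝ≥0∞}
    (hρ₁ : Measurable ρ₁) (hρ₂ : Measurable ρ₂)
    (h₁ : HasJointIntensity μ P X 1 fun x => ρ₁ (x 0))
    (h₂ : HasJointIntensity μ P X 2 fun x => ρ₂ (x 0, x 1))
    {g : M × M → ℝ≥0∞} (hg : Measurable g) :
    ∫⁻ ω, ∑ a ∈ X ω, ∑ b ∈ X ω, g (a, b) ∂P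
      = ∫⁻ p, ρ₂ p * g p ∂(μ.prod μ) + ∫⁻ a, ρ₁ a * g (a, a) ∂μ := by
  have hdiag : Measurable fun a : M => (a, a) := measurable_id.prodMk measurable_id
  have hκ := hX.measurable_pointMeasure_prod
  -- The expected counting measure of the pairs of points is `ρ₂ μ ⊗ μ` plus the image of `ρ₁ μ` on
  -- the diagonal.
  have key : P.bind (fun ω => (pointMeasure (X ω)).prod (pointMeasure (X ω)))
      = (μ.prod μ).withDensity ρ₂ + (μ.withDensity ρ₁).map fun a => (a, a) := by
    ext B hB
    have hB2 : MeasurableSet {x : Fin 2 → M | (x 0, x 1) ∈ B} :=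
      (MeasurableEquiv.finTwoArrow (α := M)).measurable hB
    have hB1 : MeasurableSet {x : Fin 1 → M | (x 0, x 0) ∈ B} :=
      (hdiag.comp (measurable_pi_apply 0)) hB
    have hcard : Measurable fun ω =>
        ((distinctTuples 1 (X ω) {x | (x 0, x 0) ∈ B}).ncard : ℝ≥0∞) := by
      have h : ∀ ω, (distinctTuples 1 (X ω) {x | (x 0, x 0) ∈ B}).ncard
          = ((X ω : Set M) ∩ {a | (a, a) ∈ B}).ncard := fun ω =>
        ncard_distinctTuples_one (X ω) {a | (a, a) ∈ B}
      simp only [h]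
      exact measurable_from_top.comp (hX _ (hdiag hB))
    rw [Measure.bind_apply hB hκ.aemeasurable]
    simp only [pointMeasure_prod_apply _ hB]
    rw [lintegral_add_right _ hcard, h₁ _ hB1, h₂ _ hB2, Measure.add_apply,
      withDensity_apply _ hB, Measure.map_apply hdiag hB, withDensity_apply _ (hdiag hB)]
    congr 1
    · exact (measurePreserving_finTwoArrow μ).setLIntegral_comp_preimage hB hρ₂
    · exact (measurePreserving_funUnique μ (Fin 1)).setLIntegral_comp_preimage (hdiag hB) hρ₁
  have hint : ∫⁻ a, g (a, a) ∂(μ.withDensity ρ₁) = ∫⁻ a, ρ₁ a * g (a, a) ∂μ :=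
    lintegral_withDensity_eq_lintegral_mul _ hρ₁ (hg.comp hdiag)
  simp only [← lintegral_pointMeasure_prod _ hg]
  rw [← Measure.lintegral_bind hκ.aemeasurable hg.aemeasurable, key, lintegral_add_measure,
    lintegral_withDensity_eq_lintegral_mul _ hρ₂ hg, lintegral_map hg hdiag, hint]
  rfl

end PointProcess

/-! ### Fourier coefficients of the pair function and the Dirichlet kernel -/

/-- The Dirichlet kernel `∑_{|k| ≤ T} exp (2 π i k z)`. -/
def dirichletKernel (T : ℕ) (z : UnitAddCircle) : ℂ :=
  ∑ k ∈ Finset.Icc (-(T : ℤ)) (T : ℤ), fourier k z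

lemma continuous_dirichletKernel (T : ℕ) : Continuous (dirichletKernel T) :=
  continuous_finsetSum _ fun k _ => (fourier k).continuous

lemma measurable_arcKernel : Measurable arcKernel :=
  measurable_const.sub (measurable_icoRep.mul (measurable_const.sub measurable_icoRep))

lemma arcKernel_nonneg (z : UnitAddCircle) : 0 ≤ arcKernel z := by
  unfold arcKernel
  nlinarith [sq_nonneg (icoRep z - 1 / 2)]

lemma arcKernel_le_one (z : UnitAddCircle) : arcKernel z ≤ 1 := by
  have h0 := icoRep_nonneg z
  have h1 := icoRep_lt_one z
  unfold arcKernel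
  nlinarith

lemma arcKernel_zero : arcKernel 0 = 1 / 2 := by
  have : icoRep 0 = 0 := icoRep_coe (u := 0) ⟨le_rfl, one_pos⟩
  simp [arcKernel, this]

lemma arcKernel_eq_periodizedBernoulli (z : UnitAddCircle) :
    arcKernel z = 1 / 3 + periodizedBernoulli 2 z := by
  have : periodizedBernoulli 2 z = bernoulliFun 2 (icoRep z) := rfl
  rw [this, bernoulliFun_two, arcKernel]
  ring

lemma integral_mul_fourier (f : UnitAddCircle → ℂ) (m : ℤ) :
    ∫ z, f z * fourier m z = fourierCoeff f (-m) := by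
  have h : (volume : Measure UnitAddCircle) = AddCircle.haarAddCircle := by
    rw [AddCircle.volume_eq_smul_haarAddCircle, ENNReal.ofReal_one, one_smul]
  rw [fourierCoeff, h, neg_neg]
  simp only [smul_eq_mul, mul_comm]

lemma fourierCoeff_one (m : ℤ) :
    fourierCoeff (fun _ : UnitAddCircle => (1 : ℂ)) m = if m = 0 then 1 else 0 := by
  have h := fourierCoeff_fourier (T := 1) 0
  have h1 : ((fourier 0 : C(AddCircle (1 : ℝ), ℂ)) : AddCircle (1 : ℝ) → ℂ) = fun _ => (1 : ℂ) :=
    funext fun z => fourier_zero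
  rw [h1] at h
  rw [h, Pi.single_apply]

lemma integral_fourier_circle (m : ℤ) :
    ∫ z : UnitAddCircle, ((1 : ℝ) : ℂ) * fourier m z = ((if m = 0 then 1 else 0 : ℝ) : ℂ) := by
  have h := integral_mul_fourier (fun _ => (1 : ℂ)) m
  rw [fourierCoeff_one] at h
  simp only [Complex.ofReal_one, h, neg_eq_zero]
  split_ifs <;> simp

/-- Since `arcKernel` is `1/3` plus the second Bernoulli polynomial, its Fourier coefficients are
`1/3` at `0` and `1 / (2 π² m²)` elsewhere. At `m = 0` the second summand on the right is `0`, by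
division by zero. -/
lemma integral_arcKernel_mul_fourier (m : ℤ) :
    ∫ z, (arcKernel z : ℂ) * fourier m z
      = (((if m = 0 then 1 / 3 else 0) + 1 / (2 * Real.pi ^ 2 * (m : ℝ) ^ 2) : ℝ) : ℂ) := by
  have hc : Continuous fun z : UnitAddCircle => (periodizedBernoulli 2 z : ℂ) :=
    Complex.continuous_ofReal.comp (periodizedBernoulli.continuous (by norm_num))
  have h1 : ∀ z : UnitAddCircle, (arcKernel z : ℂ) * fourier m z
      = (1 / 3) * (((1 : ℝ) : ℂ) * fourier m z) + (periodizedBernoulli 2 z : ℂ) * fourier m z := by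
    intro z
    rw [arcKernel_eq_periodizedBernoulli]
    push_cast
    ring
  have h2 : ∫ z : UnitAddCircle, (periodizedBernoulli 2 z : ℂ) * fourier m z
      = fourierCoeff ((↑) ∘ periodizedBernoulli 2 : UnitAddCircle → ℂ) (-m) :=
    integral_mul_fourier _ m
  simp only [h1]
  rw [integral_add, integral_const_mul, integral_fourier_circle, h2,
    fourierCoeff_bernoulli_eq two_ne_zero]
  · have hI : (2 * (Real.pi : ℂ) * Complex.I * ((-m : ℤ) : ℂ)) ^ 2
        = -(2 * (2 * Real.pi ^ 2 * (m : ℂ) ^ 2)) := by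
      push_cast
      linear_combination (4 * (Real.pi : ℂ) ^ 2 * (m : ℂ) ^ 2) * Complex.I_sq
    rw [hI, neg_div_neg_eq]
    simp only [Nat.factorial_two, Nat.cast_ofNat]
    rw [div_mul_cancel_left₀ (two_ne_zero' ℂ)]
    push_cast
    split_ifs <;> simp
  · exact ((continuous_const.mul (continuous_const.mul
      (fourier m).continuous)).integrable_of_hasCompactSupport (HasCompactSupport.of_compactSpace _))
  · exact ((hc.mul (fourier m).continuous).integrable_of_hasCompactSupport
      (HasCompactSupport.of_compactSpace _))

lemma sum_Icc_neg_self {E : Type*} [AddCommMonoid E] (T : ℕ) (f : ℤ → E) :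
    ∑ k ∈ Finset.Icc (-(T : ℤ)) (T : ℤ), f k
      = ∑ i ∈ Finset.range (2 * T + 1), f ((i : ℤ) - T) := by
  refine Finset.sum_bij' (fun k _ => (k + T).toNat) (fun i _ => (i : ℤ) - T) ?_ ?_ ?_ ?_ ?_
  · intro k hk
    rw [Finset.mem_Icc] at hk
    rw [Finset.mem_range]
    omega
  · intro i hi
    rw [Finset.mem_range] at hi
    rw [Finset.mem_Icc]
    omega
  · intro k hk
    rw [Finset.mem_Icc] at hk
    omega
  · intro i hi
    simp
  · intro k hk
    rw [Finset.mem_Icc] at hk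
    congr 1
    omega

lemma normSq_dirichletKernel (T : ℕ) (z : UnitAddCircle) :
    (Complex.normSq (dirichletKernel T z) : ℂ)
      = ∑ i ∈ Finset.range (2 * T + 1), ∑ j ∈ Finset.range (2 * T + 1),
          fourier ((i : ℤ) - (j : ℤ)) z := by
  rw [← Complex.mul_conj, dirichletKernel, sum_Icc_neg_self, map_sum, Finset.sum_mul_sum]
  refine Finset.sum_congr rfl fun i _ => Finset.sum_congr rfl fun j _ => ?_
  rw [← fourier_neg, ← fourier_add]
  congr 2
  ring

/-- Each difference `±m` occurs `n - m` times; the term `m = 0` is counted twice in the first sum on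
the right, whence the correction `n c(0)`. -/
lemma sum_range_sub_of_even (c : ℤ → ℝ) (hc : ∀ m, c (-m) = c m) (n : ℕ) :
    ∑ i ∈ Finset.range n, ∑ j ∈ Finset.range n, c ((i : ℤ) - (j : ℤ))
      = 2 * ∑ m ∈ Finset.range n, ((n : ℝ) - m) * c m - n * c 0 := by
  induction n with
  | zero => simp
  | succ n ih =>
    have hr : ∑ i ∈ Finset.range n, c ((n : ℤ) - (i : ℤ))
        = ∑ m ∈ Finset.range (n + 1), c m - c 0 := by
      rw [Finset.sum_range_succ', ← Finset.sum_range_reflect]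
      simp only [Nat.cast_zero, add_sub_cancel_right]
      refine Finset.sum_congr rfl fun i hi => ?_
      rw [Finset.mem_range] at hi
      congr 1
      omega
    have hr' : ∑ i ∈ Finset.range n, c ((i : ℤ) - (n : ℤ))
        = ∑ m ∈ Finset.range (n + 1), c m - c 0 := by
      rw [← hr]
      exact Finset.sum_congr rfl fun i _ => by rw [← hc, neg_sub]
    have hs : ∑ m ∈ Finset.range (n + 1), (((n + 1 : ℕ) : ℝ) - m) * c m
        = ∑ m ∈ Finset.range n, ((n : ℝ) - m) * c m + ∑ m ∈ Finset.range (n + 1), c m := by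
      have : ∀ m : ℕ, (((n + 1 : ℕ) : ℝ) - m) * c m = ((n : ℝ) - m) * c m + c m := fun m => by
        push_cast; ring
      simp only [this]
      rw [Finset.sum_add_distrib, Finset.sum_range_succ]
      simp
    rw [Finset.sum_range_succ]
    simp only [Finset.sum_range_succ _ n, Finset.sum_add_distrib] at hs hr hr' ⊢
    rw [ih, hr, hr']
    simp only [sub_self]
    push_cast at hs ⊢
    linarith

/-- Integrating a weight against the Fejér-type kernel `|D_T|²`, in terms of the Fourier coefficients
of the weight. -/
lemma integral_mul_normSq_dirichletKernel {w : UnitAddCircle → ℝ} (hw : Measurable w)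
    (hb : ∀ z, |w z| ≤ 1) {c : ℤ → ℝ} (hc : ∀ m, c (-m) = c m)
    (hcw : ∀ m, ∫ z, (w z : ℂ) * fourier m z = (c m : ℂ)) (T : ℕ) :
    ∫ z, w z * Complex.normSq (dirichletKernel T z)
      = 2 * ∑ m ∈ Finset.range (2 * T + 1), (((2 * T + 1 : ℕ) : ℝ) - m) * c m
        - ((2 * T + 1 : ℕ) : ℝ) * c 0 := by
  have hint : ∀ m : ℤ, Integrable fun z : UnitAddCircle => (w z : ℂ) * fourier m z := fun m => by
    refine Integrable.of_bound (C := 1) ?_ (Eventually.of_forall fun z => ?_)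
    · exact ((Complex.measurable_ofReal.comp hw).mul
        (fourier m).continuous.measurable).aestronglyMeasurable
    · rw [norm_mul, Complex.norm_real, fourier_apply, Circle.norm_coe, mul_one]
      exact hb z
  have hsum : ∫ z, w z * Complex.normSq (dirichletKernel T z)
      = ∑ i ∈ Finset.range (2 * T + 1), ∑ j ∈ Finset.range (2 * T + 1),
          c ((i : ℤ) - (j : ℤ)) := by
    apply Complex.ofReal_injective
    rw [← integral_complex_ofReal]
    simp only [Complex.ofReal_mul, normSq_dirichletKernel, Finset.mul_sum, Complex.ofReal_sum]
    rw [integral_finsetSum _ fun i _ => integrable_finsetSum _ fun j _ => hint _]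
    refine Finset.sum_congr rfl fun i _ => ?_
    rw [integral_finsetSum _ fun j _ => hint _]
    exact Finset.sum_congr rfl fun j _ => hcw _
  rw [hsum, sum_range_sub_of_even c hc]

lemma integral_normSq_dirichletKernel (T : ℕ) :
    ∫ z, Complex.normSq (dirichletKernel T z) = ((2 * T + 1 : ℕ) : ℝ) := by
  have h := integral_mul_normSq_dirichletKernel (w := fun _ => 1) measurable_const (by simp)
    (c := fun m => if m = 0 then 1 else 0) (by simp) integral_fourier_circle T
  simp only [one_mul] at h
  rw [h, Finset.sum_eq_single_of_mem 0 (by simp)]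
  · simp; ring
  · intro b _ hb
    simp [hb]

/-- The integral of the pair function of the circle against `|D_T|²`, where `n = 2T + 1`. The terms
`m = 0` vanish, by division by zero. -/
def circlePairIntegral (n : ℕ) : ℝ :=
  n / 3 + (n * ∑ m ∈ Finset.range n, 1 / (m : ℝ) ^ 2 - ∑ m ∈ Finset.range n, 1 / (m : ℝ))
    / Real.pi ^ 2

lemma integral_arcKernel_mul_normSq (T : ℕ) :
    ∫ z, arcKernel z * Complex.normSq (dirichletKernel T z)
      = circlePairIntegral (2 * T + 1) := by
  rw [integral_mul_normSq_dirichletKernel measurable_arcKernel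
    (fun z => by rw [abs_of_nonneg (arcKernel_nonneg z)]; exact arcKernel_le_one z)
    (by simp) integral_arcKernel_mul_fourier T, circlePairIntegral]
  set n := 2 * T + 1 with hn
  have hterm : ∀ m : ℕ, ((n : ℝ) - m) * ((if (m : ℤ) = 0 then 1 / 3 else 0)
      + 1 / (2 * Real.pi ^ 2 * ((m : ℤ) : ℝ) ^ 2))
      = (if m = 0 then (n : ℝ) / 3 else 0)
        + ((n * (1 / (m : ℝ) ^ 2) - 1 / (m : ℝ)) / (2 * Real.pi ^ 2)) := by
    intro m
    rcases Nat.eq_zero_or_pos m with rfl | hm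
    · simp; ring
    · have hm' : (m : ℝ) ≠ 0 := by positivity
      rw [if_neg (by omega), if_neg (by omega), Int.cast_natCast, zero_add, zero_add]
      field_simp
  simp only [hterm]
  rw [Finset.sum_add_distrib, Finset.sum_ite_eq' _ 0, if_pos (by simp [hn]), ← Finset.sum_div,
    Finset.sum_sub_distrib, ← Finset.mul_sum]
  simp
  ring

/-! ### The exact expectation for the harmonic ensemble -/

lemma harmonicKernel_eq_prod (d T : ℕ) (x y : Torus d) :
    harmonicKernel d T x y = ∏ j, dirichletKernel T (x j - y j) := by
  simp only [harmonicKernel, dirichletKernel]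
  rw [Finset.prod_univ_sum]
  rfl

lemma dirichletKernel_zero (T : ℕ) : dirichletKernel T 0 = ((2 * T + 1 : ℕ) : ℂ) := by
  rw [dirichletKernel, sum_Icc_neg_self]
  simp

lemma dirichletKernel_neg (T : ℕ) (z : UnitAddCircle) :
    dirichletKernel T (-z) = (starRingEnd ℂ) (dirichletKernel T z) := by
  simp only [dirichletKernel, map_sum, ← fourier_neg]
  refine Finset.sum_congr rfl fun k _ => ?_
  simp only [fourier_apply, smul_neg, neg_smul]

lemma norm_dirichletKernel_le (T : ℕ) (z : UnitAddCircle) :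
    ‖dirichletKernel T z‖ ≤ ((2 * T + 1 : ℕ) : ℝ) := by
  rw [dirichletKernel, sum_Icc_neg_self]
  refine (norm_sum_le _ _).trans ?_
  simp [fourier_apply, Circle.norm_coe]

/-- The squared modulus of the harmonic kernel, as a function of `x - y`. -/
def kernelSq (d T : ℕ) (z : Torus d) : ℝ := ∏ j, Complex.normSq (dirichletKernel T (z j))

lemma kernelSq_nonneg (d T : ℕ) (z : Torus d) : 0 ≤ kernelSq d T z :=
  Finset.prod_nonneg fun _ _ => Complex.normSq_nonneg _

lemma kernelSq_le (d T : ℕ) (z : Torus d) :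
    kernelSq d T z ≤ (((2 * T + 1) ^ d : ℕ) : ℝ) ^ 2 := by
  have h : ∀ j, Complex.normSq (dirichletKernel T (z j)) ≤ ((2 * T + 1 : ℕ) : ℝ) ^ 2 := fun j => by
    rw [Complex.normSq_eq_norm_sq]
    exact pow_le_pow_left₀ (norm_nonneg _) (norm_dirichletKernel_le T _) 2
  refine (Finset.prod_le_prod (fun _ _ => Complex.normSq_nonneg _) fun j _ => h j).trans_eq ?_
  simp only [Finset.prod_const, Finset.card_univ, Fintype.card_fin]
  rw [Nat.cast_pow, pow_right_comm]

lemma measurable_kernelSq (d T : ℕ) : Measurable (kernelSq d T) :=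
  Finset.measurable_fun_prod _ fun j _ => Complex.continuous_normSq.measurable.comp
    ((continuous_dirichletKernel T).measurable.comp (measurable_pi_apply j))

lemma harmonicKernel_det_one (d T : ℕ) (x : Fin 1 → Torus d) :
    (Matrix.det (Matrix.of fun i j : Fin 1 => harmonicKernel d T (x i) (x j))).re
      = (((2 * T + 1) ^ d : ℕ) : ℝ) := by
  rw [Matrix.det_fin_one, Matrix.of_apply, harmonicKernel_eq_prod]
  simp only [sub_self, dirichletKernel_zero, Finset.prod_const, Finset.card_univ, Fintype.card_fin]
  rw [← Nat.cast_pow, Complex.natCast_re]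

lemma harmonicKernel_det_two (d T : ℕ) (x : Fin 2 → Torus d) :
    (Matrix.det (Matrix.of fun i j : Fin 2 => harmonicKernel d T (x i) (x j))).re
      = (((2 * T + 1) ^ d : ℕ) : ℝ) ^ 2 - kernelSq d T (x 1 - x 0) := by
  have h : harmonicKernel d T (x 0) (x 1) * harmonicKernel d T (x 1) (x 0)
      = ((kernelSq d T (x 1 - x 0) : ℝ) : ℂ) := by
    rw [harmonicKernel_eq_prod, harmonicKernel_eq_prod, ← Finset.prod_mul_distrib, kernelSq,
      Complex.ofReal_prod]
    refine Finset.prod_congr rfl fun j _ => ?_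
    rw [← neg_sub (x 1 j) (x 0 j), dirichletKernel_neg, mul_comm, Complex.mul_conj]
    rfl
  rw [Matrix.det_fin_two]
  simp only [Matrix.of_apply]
  rw [h, harmonicKernel_eq_prod, harmonicKernel_eq_prod]
  simp only [sub_self, dirichletKernel_zero, Finset.prod_const, Finset.card_univ, Fintype.card_fin]
  rw [Complex.sub_re, Complex.ofReal_re, ← Nat.cast_pow, ← Nat.cast_mul, Complex.natCast_re]
  push_cast
  ring

variable {Ω : Type*} [MeasurableSpace Ω] {d T : ℕ} {P : Measure Ω} {X : Ω → Finset (Torus d)}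

lemma integral_comp_sub_prod {d : ℕ} {F : Torus d → ℝ} (hF : Measurable F) {C : ℝ}
    (hb : ∀ z, |F z| ≤ C) :
    ∫ p : Torus d × Torus d, F (p.2 - p.1) ∂(volume.prod volume) = ∫ z, F z := by
  have hi : Integrable (fun p : Torus d × Torus d => F (p.2 - p.1)) (volume.prod volume) :=
    Integrable.of_bound (C := C) (hF.comp (measurable_snd.sub measurable_fst)).aestronglyMeasurable
      (Eventually.of_forall fun p => hb _)
  rw [integral_prod _ hi]
  have : ∀ x : Torus d, ∫ y, F (y - x) = ∫ z, F z := fun x => integral_sub_right_eq_self F x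
  simp only [this, integral_const, probReal_univ, one_smul]

/-- The expected pair sum of a translation invariant function over the harmonic ensemble: the pairs
of distinct points have intensity `N² - |K|²`, and the diagonal pairs contribute `N w(0)`. -/
lemma IsHarmonicEnsemble.integral_pair_sum (hX : IsHarmonicEnsemble d T P X) {w : Torus d → ℝ}
    (hw : Measurable w) (h0 : ∀ z, 0 ≤ w z) (h1 : ∀ z, w z ≤ 1) :
    Integrable (fun ω => ∑ a ∈ X ω, ∑ b ∈ X ω, w (b - a)) P ∧
    ∫ ω, ∑ a ∈ X ω, ∑ b ∈ X ω, w (b - a) ∂P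
      = (((2 * T + 1) ^ d : ℕ) : ℝ) ^ 2 * (∫ z, w z) - (∫ z, w z * kernelSq d T z)
        + (((2 * T + 1) ^ d : ℕ) : ℝ) * w 0 := by
  set N : ℕ := (2 * T + 1) ^ d with hN
  set F : Torus d → ℝ := fun z => ((N : ℝ) ^ 2 - kernelSq d T z) * w z with hF
  have hk0 := kernelSq_nonneg d T
  have hk1 : ∀ z, kernelSq d T z ≤ (N : ℝ) ^ 2 := kernelSq_le d T
  have hsub : Measurable fun p : Torus d × Torus d => p.2 - p.1 := measurable_snd.sub measurable_fst
  have hFm : Measurable F := (measurable_const.sub (measurable_kernelSq d T)).mul hw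
  have hF0 : ∀ z, 0 ≤ F z := fun z => mul_nonneg (sub_nonneg.2 (hk1 z)) (h0 z)
  have hF1 : ∀ z, |F z| ≤ (N : ℝ) ^ 2 := fun z => by
    rw [abs_of_nonneg (hF0 z)]
    calc F z ≤ ((N : ℝ) ^ 2 - kernelSq d T z) * 1 :=
          mul_le_mul_of_nonneg_left (h1 z) (sub_nonneg.2 (hk1 z))
      _ ≤ (N : ℝ) ^ 2 := by linarith [hk0 z]
  have hgm : Measurable fun p : Torus d × Torus d => ENNReal.ofReal (w (p.2 - p.1)) :=
    ENNReal.measurable_ofReal.comp (hw.comp hsub)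
  have hS : ∀ ω, ENNReal.ofReal (∑ a ∈ X ω, ∑ b ∈ X ω, w (b - a))
      = ∑ a ∈ X ω, ∑ b ∈ X ω, ENNReal.ofReal (w (b - a)) := fun ω => by
    rw [ENNReal.ofReal_sum_of_nonneg fun a _ => Finset.sum_nonneg fun b _ => h0 _]
    exact Finset.sum_congr rfl fun a _ => ENNReal.ofReal_sum_of_nonneg fun b _ => h0 _
  have hS0 : ∀ ω, 0 ≤ ∑ a ∈ X ω, ∑ b ∈ X ω, w (b - a) := fun ω =>
    Finset.sum_nonneg fun a _ => Finset.sum_nonneg fun b _ => h0 _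
  have hSm : Measurable fun ω => ∑ a ∈ X ω, ∑ b ∈ X ω, w (b - a) := by
    have := (hX.simple.measurable_pair_sum hgm).ennreal_toReal
    simpa only [← hS, ENNReal.toReal_ofReal (hS0 _)] using this
  have hFint : Integrable (fun p : Torus d × Torus d => F (p.2 - p.1)) (volume.prod volume) :=
    Integrable.of_bound (C := (N : ℝ) ^ 2) (hFm.comp hsub).aestronglyMeasurable
      (Eventually.of_forall fun p => hF1 _)
  have hl : ∫⁻ ω, ENNReal.ofReal (∑ a ∈ X ω, ∑ b ∈ X ω, w (b - a)) ∂P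
      = ENNReal.ofReal ((∫ z, F z) + (N : ℝ) * w 0) := by
    simp only [hS]
    rw [lintegral_pair_sum (μ := volume) (ρ₁ := fun _ => ENNReal.ofReal N)
      (ρ₂ := fun p => ENNReal.ofReal ((N : ℝ) ^ 2 - kernelSq d T (p.2 - p.1))) hX.simple
      measurable_const (ENNReal.measurable_ofReal.comp
        (measurable_const.sub ((measurable_kernelSq d T).comp hsub))) ?_ ?_ hgm]
    · rw [ENNReal.ofReal_add (integral_nonneg hF0) (mul_nonneg N.cast_nonneg (h0 0))]
      congr 1
      · rw [← integral_comp_sub_prod hFm hF1, ofReal_integral_eq_lintegral_ofReal hFint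
          (Eventually.of_forall fun p => hF0 _)]
        exact lintegral_congr fun p => (ENNReal.ofReal_mul (sub_nonneg.2 (hk1 _))).symm
      · simp only [sub_self, lintegral_const, measure_univ, mul_one]
        rw [ENNReal.ofReal_mul N.cast_nonneg]
    · have := hX.jointIntensity 1
      simpa only [harmonicKernel_det_one] using this
    · have := hX.jointIntensity 2
      simpa only [harmonicKernel_det_two] using this
  have hc0 : 0 ≤ (∫ z, F z) + (N : ℝ) * w 0 :=
    add_nonneg (integral_nonneg hF0) (mul_nonneg N.cast_nonneg (h0 0))
  refine ⟨⟨hSm.aestronglyMeasurable, ?_⟩, ?_⟩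
  · rw [hasFiniteIntegral_iff_ofReal (Eventually.of_forall hS0), hl]
    exact ENNReal.ofReal_lt_top
  · rw [integral_eq_lintegral_of_nonneg_ae (Eventually.of_forall hS0) hSm.aestronglyMeasurable, hl,
      ENNReal.toReal_ofReal hc0]
    congr 1
    have hwi : Integrable w := Integrable.of_bound (C := 1) hw.aestronglyMeasurable
      (Eventually.of_forall fun z => by rw [Real.norm_of_nonneg (h0 z)]; exact h1 z)
    have hki : Integrable fun z => w z * kernelSq d T z :=
      Integrable.of_bound (C := (N : ℝ) ^ 2) (hw.mul (measurable_kernelSq d T)).aestronglyMeasurable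
        (Eventually.of_forall fun z => by
          rw [Real.norm_of_nonneg (mul_nonneg (h0 z) (hk0 z))]
          nlinarith [h0 z, h1 z, hk0 z, hk1 z])
    rw [← integral_const_mul, ← integral_sub (hwi.const_mul _) hki]
    exact integral_congr_ae (Eventually.of_forall fun z => by simp only [hF]; ring)

lemma IsHarmonicEnsemble.integral_card (hX : IsHarmonicEnsemble d T P X) :
    Integrable (fun ω => ((X ω).card : ℝ)) P ∧
      ∫ ω, ((X ω).card : ℝ) ∂P = (((2 * T + 1) ^ d : ℕ) : ℝ) := by
  have hm : Measurable fun ω => ((X ω).card : ℝ) := by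
    have := hX.simple Set.univ MeasurableSet.univ
    simp only [Set.inter_univ, Set.ncard_coe_finset] at this
    exact measurable_from_top.comp this
  have h := hX.jointIntensity 1 Set.univ MeasurableSet.univ
  have hc : ∀ ω, (distinctTuples 1 (X ω) Set.univ).ncard = (X ω).card := fun ω => by
    have h1 := ncard_distinctTuples_one (X ω) Set.univ
    rwa [Set.inter_univ, Set.ncard_coe_finset] at h1
  simp only [hc, harmonicKernel_det_one, ENNReal.ofReal_natCast, lintegral_const,
    Measure.restrict_univ, measure_univ, mul_one] at h
  have h0 : ∀ ω, (0 : ℝ) ≤ (X ω).card := fun ω => Nat.cast_nonneg _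
  refine ⟨⟨hm.aestronglyMeasurable, ?_⟩, ?_⟩
  · rw [hasFiniteIntegral_iff_ofReal (Eventually.of_forall h0)]
    simp only [ENNReal.ofReal_natCast, h]
    exact ENNReal.natCast_lt_top _
  · rw [integral_eq_lintegral_of_nonneg_ae (Eventually.of_forall h0) hm.aestronglyMeasurable]
    simp only [ENNReal.ofReal_natCast, h, ENNReal.toReal_natCast]

/-- The number of points has mean `N` and, since `|K|²` integrates to `N`, variance zero. -/
lemma IsHarmonicEnsemble.ae_card_eq [IsProbabilityMeasure P] (hX : IsHarmonicEnsemble d T P X) :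
    ∀ᵐ ω ∂P, (X ω).card = (2 * T + 1) ^ d := by
  obtain ⟨hi1, he1⟩ := hX.integral_card
  obtain ⟨hi2, he2⟩ := hX.integral_pair_sum (w := fun _ => 1) measurable_const (by simp) (by simp)
  have hk : ∫ z, kernelSq d T z = (((2 * T + 1) ^ d : ℕ) : ℝ) := by
    simp only [kernelSq]
    rw [integral_fintype_prod_volume_eq_prod (𝕜 := ℝ)
      fun _ z => Complex.normSq (dirichletKernel T z)]
    simp only [integral_normSq_dirichletKernel, Finset.prod_const, Finset.card_univ,
      Fintype.card_fin]
    push_cast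
    rfl
  simp only [Finset.sum_const, nsmul_eq_mul, mul_one, one_mul, hk, integral_const, probReal_univ,
    one_smul] at hi2 he2
  set N : ℕ := (2 * T + 1) ^ d with hN
  have hsq : ∀ ω, (((X ω).card : ℝ) - N) ^ 2
      = (((X ω).card : ℝ) * (X ω).card - 2 * N * (X ω).card) + (N : ℝ) ^ 2 := fun ω => by ring
  have hi3 : Integrable
      (fun ω => ((X ω).card : ℝ) * (X ω).card - 2 * N * (X ω).card) P :=
    hi2.sub (hi1.const_mul _)
  have hi : Integrable (fun ω => (((X ω).card : ℝ) - N) ^ 2) P := by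
    simp only [hsq]
    exact hi3.add (integrable_const _)
  have hz : ∫ ω, (((X ω).card : ℝ) - N) ^ 2 ∂P = 0 := by
    simp only [hsq]
    rw [integral_add hi3 (integrable_const _), integral_sub hi2 (hi1.const_mul _),
      integral_const_mul, he1, he2, integral_const, probReal_univ, one_smul]
    ring
  have hae := (integral_eq_zero_iff_of_nonneg (fun ω => sq_nonneg _) hi).1 hz
  filter_upwards [hae] with ω hω
  have : ((X ω).card : ℝ) - N = 0 := by simpa using hω
  exact_mod_cast sub_eq_zero.1 this

lemma integral_boxKernel (d : ℕ) : ∫ z : Torus d, boxKernel z = (1 / 3) ^ d := by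
  simp only [boxKernel]
  rw [integral_fintype_prod_volume_eq_prod (𝕜 := ℝ) fun _ z => arcKernel z]
  have h : ∫ z, arcKernel z = 1 / 3 := by
    have h := integral_arcKernel_mul_fourier 0
    simp only [fourier_zero, mul_one, if_true] at h
    rw [integral_complex_ofReal] at h
    rw [Complex.ofReal_injective h]
    simp
  simp [h]

lemma integral_boxKernel_mul_kernelSq (d T : ℕ) :
    ∫ z : Torus d, boxKernel z * kernelSq d T z = circlePairIntegral (2 * T + 1) ^ d := by
  simp only [boxKernel, kernelSq, ← Finset.prod_mul_distrib]
  rw [integral_fintype_prod_volume_eq_prod (𝕜 := ℝ)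
    fun _ z => arcKernel z * Complex.normSq (dirichletKernel T z)]
  simp [integral_arcKernel_mul_normSq]

/-- The exact mean square discrepancy of the harmonic ensemble, with `n = 2T + 1` and `N = n ^ d`:
`((n/2)^d - J^d) / N²`, where `J` is `circlePairIntegral n`. The constant `N² 3⁻ᵈ` in the expected
pair sum cancels against the constant in `periodicDiscrepancy_sq`. -/
theorem IsHarmonicEnsemble.integral_discrepancy_sq [IsProbabilityMeasure P]
    (hX : IsHarmonicEnsemble d T P X) :
    Integrable (fun ω => periodicDiscrepancy (X ω) ^ 2) P ∧
    ∫ ω, periodicDiscrepancy (X ω) ^ 2 ∂P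
      = ((((2 * T + 1 : ℕ) : ℝ) / 2) ^ d - circlePairIntegral (2 * T + 1) ^ d)
        / (((2 * T + 1) ^ d : ℕ) : ℝ) ^ 2 := by
  have hm : Measurable (boxKernel : Torus d → ℝ) :=
    Finset.measurable_fun_prod _ fun j _ => measurable_arcKernel.comp (measurable_pi_apply j)
  obtain ⟨hi, he⟩ := hX.integral_pair_sum hm
    (fun z => Finset.prod_nonneg fun _ _ => arcKernel_nonneg _)
    (fun z => Finset.prod_le_one (fun _ _ => arcKernel_nonneg _) fun _ _ => arcKernel_le_one _)
  have hN0 : (2 * T + 1) ^ d ≠ 0 := by positivity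
  have hae : (fun ω => periodicDiscrepancy (X ω) ^ 2) =ᵐ[P] fun ω =>
      (1 / (((2 * T + 1) ^ d : ℕ) : ℝ) ^ 2) * (∑ a ∈ X ω, ∑ b ∈ X ω, boxKernel (b - a))
        - (1 / 3) ^ d := by
    filter_upwards [hX.ae_card_eq] with ω hω using periodicDiscrepancy_sq hN0 hω
  refine ⟨((hi.const_mul _).sub (integrable_const _)).congr hae.symm, ?_⟩
  rw [integral_congr_ae hae, integral_sub (hi.const_mul _) (integrable_const _),
    integral_const_mul, he, integral_boxKernel, integral_boxKernel_mul_kernelSq, integral_const,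
    probReal_univ, one_smul]
  have hb0 : boxKernel (0 : Torus d) = (1 / 2) ^ d := by
    simp [boxKernel, arcKernel_zero]
  have hN0' : (((2 * T + 1) ^ d : ℕ) : ℝ) ≠ 0 := by exact_mod_cast hN0
  rw [hb0]
  have h2 : (((2 * T + 1 : ℕ) : ℝ) / 2) ^ d = (((2 * T + 1) ^ d : ℕ) : ℝ) * (1 / 2) ^ d := by
    push_cast
    rw [div_pow, div_eq_mul_one_div, one_div_pow]
  rw [h2]
  field_simp
  ring

/-! ### Asymptotics -/

lemma tendsto_sum_range_inv_sq_add {f : ℕ → ℝ} (hf : Tendsto f atTop (nhds 0)) (r : ℕ) :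
    Tendsto (fun k : ℕ => ∑ m ∈ Finset.range (k + r), 1 / (m : ℝ) ^ 2 + f k) atTop
      (nhds (Real.pi ^ 2 / 6)) := by
  have h := (hasSum_zeta_two.tendsto_sum_nat.comp (tendsto_add_atTop_nat r)).add hf
  rwa [add_zero] at h

/-- The sequence `∑_{m ≤ k} 1/m² + 1/(k+1)` increases to `π²/6`. -/
lemma one_div_le_zeta_two_tail (k : ℕ) :
    1 / ((k : ℝ) + 1) ≤ Real.pi ^ 2 / 6 - ∑ m ∈ Finset.range (k + 1), 1 / (m : ℝ) ^ 2 := by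
  have hmono : Monotone fun k : ℕ =>
      ∑ m ∈ Finset.range (k + 1), 1 / (m : ℝ) ^ 2 + 1 / ((k : ℝ) + 1) := by
    refine monotone_nat_of_le_succ fun k => ?_
    rw [Finset.sum_range_succ _ (k + 1)]
    push_cast
    have h : 1 / ((k : ℝ) + 1) ≤ 1 / ((k : ℝ) + 1) ^ 2 + 1 / ((k : ℝ) + 1 + 1) := by
      have hk : (0 : ℝ) ≤ k := k.cast_nonneg
      rw [← sub_nonneg]
      have : 1 / ((k : ℝ) + 1) ^ 2 + 1 / ((k : ℝ) + 1 + 1) - 1 / ((k : ℝ) + 1)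
          = 1 / (((k : ℝ) + 1) ^ 2 * (k + 1 + 1)) := by
        field_simp
        ring
      rw [this]
      positivity
    linarith
  have := hmono.ge_of_tendsto
    (tendsto_sum_range_inv_sq_add tendsto_one_div_add_atTop_nhds_zero_nat 1) k
  linarith

/-- The sequence `∑_{m ≤ k+1} 1/m² + 1/(k+1)` decreases to `π²/6`. -/
lemma zeta_two_tail_le_one_div (k : ℕ) :
    Real.pi ^ 2 / 6 - ∑ m ∈ Finset.range (k + 2), 1 / (m : ℝ) ^ 2 ≤ 1 / ((k : ℝ) + 1) := by
  have hanti : Antitone fun k : ℕ =>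
      ∑ m ∈ Finset.range (k + 2), 1 / (m : ℝ) ^ 2 + 1 / ((k : ℝ) + 1) := by
    refine antitone_nat_of_succ_le fun k => ?_
    rw [Finset.sum_range_succ _ (k + 2)]
    push_cast
    have h : 1 / ((k : ℝ) + 2) ^ 2 + 1 / ((k : ℝ) + 1 + 1) ≤ 1 / ((k : ℝ) + 1) := by
      have hk : (0 : ℝ) ≤ k := k.cast_nonneg
      rw [← sub_nonneg]
      have : 1 / ((k : ℝ) + 1) - (1 / ((k : ℝ) + 2) ^ 2 + 1 / ((k : ℝ) + 1 + 1))
          = 1 / (((k : ℝ) + 2) ^ 2 * (k + 1)) := by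
        rw [add_assoc (k : ℝ) 1 1, one_add_one_eq_two]
        field_simp
        ring
      rw [this]
      positivity
    linarith
  have := hanti.le_of_tendsto
    (tendsto_sum_range_inv_sq_add tendsto_one_div_add_atTop_nhds_zero_nat 2) k
  linarith

lemma abs_sum_range_inv_sub_log_le (k : ℕ) :
    |∑ m ∈ Finset.range (k + 1), 1 / (m : ℝ) - Real.log ((k : ℝ) + 1)
      - Real.eulerMascheroniConstant| ≤ 1 / ((k : ℝ) + 1) := by
  have h : ∑ m ∈ Finset.range (k + 1), 1 / (m : ℝ) = (harmonic k : ℝ) := by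
    rw [Finset.sum_range_succ', harmonic]
    push_cast
    simp
  have h1 := Real.eulerMascheroniSeq_lt_eulerMascheroniConstant k
  have h2 := Real.eulerMascheroniConstant_lt_eulerMascheroniSeq' (k + 1)
  rw [Real.eulerMascheroniSeq] at h1
  rw [Real.eulerMascheroniSeq', if_neg (Nat.succ_ne_zero k), harmonic_succ] at h2
  push_cast at h2
  rw [h, abs_le, one_div]
  constructor <;> linarith

/-- The defect `n/2 - circlePairIntegral n`, which drives the discrepancy. -/
def circleDefect (n : ℕ) : ℝ := n / 2 - circlePairIntegral n

/-- The defect is `(n ∑_{m ≥ n} 1/m² + ∑_{m < n} 1/m) / π²`. The tail of `ζ(2)` is `1/n + O(1/n²)`,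
which produces the summand `1`, and the harmonic sum produces `log n + γ`. -/
lemma abs_circleDefect_sub_le {n : ℕ} (hn : 2 ≤ n) :
    |Real.pi ^ 2 * circleDefect n - (Real.log n + Real.eulerMascheroniConstant + 1)|
      ≤ 3 / (n : ℝ) := by
  obtain ⟨k, hnk'⟩ := Nat.exists_eq_add_of_le' hn
  have hk : (0 : ℝ) ≤ k := k.cast_nonneg
  have h1 := one_div_le_zeta_two_tail (k + 1)
  have h2 := zeta_two_tail_le_one_div k
  have h3 := abs_le.1 (abs_sum_range_inv_sub_log_le (k + 1))
  have hcast : (((k + 1 : ℕ) : ℝ) + 1) = ((k + 2 : ℕ) : ℝ) := by push_cast; ring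
  rw [hcast, add_assoc k 1 1, one_add_one_eq_two, ← hnk'] at h1 h3
  rw [← hnk'] at h2
  have hnk : (n : ℝ) = k + 2 := by rw [hnk']; push_cast; ring
  have hn0 : (0 : ℝ) < n := by rw [hnk]; positivity
  set Z := ∑ m ∈ Finset.range n, 1 / (m : ℝ) ^ 2
  set h := ∑ m ∈ Finset.range n, 1 / (m : ℝ)
  have hpi : Real.pi ≠ 0 := Real.pi_ne_zero
  have hexp : Real.pi ^ 2 * circleDefect n = n * (Real.pi ^ 2 / 6 - Z) + h := by
    rw [circleDefect, circlePairIntegral]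
    field_simp
    ring
  have h1' : 1 ≤ n * (Real.pi ^ 2 / 6 - Z) := by
    have := mul_le_mul_of_nonneg_left h1 hn0.le
    rwa [mul_one_div_cancel hn0.ne'] at this
  have h2' : n * (Real.pi ^ 2 / 6 - Z) ≤ 1 + 2 / n := by
    refine (mul_le_mul_of_nonneg_left h2 hn0.le).trans ?_
    rw [hnk, ← sub_nonneg]
    have : 1 + 2 / ((k : ℝ) + 2) - (k + 2) * (1 / (k + 1)) = k / ((k + 2) * (k + 1)) := by
      field_simp
      ring
    rw [this]
    positivity
  have h4 : (3 : ℝ) / n = 1 / n + 2 / n := by ring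
  have h5 : (0 : ℝ) ≤ 2 / n := by positivity
  rw [hexp, h4, abs_le]
  constructor <;> linarith [h3.1, h3.2]

lemma one_le_log_natCast {n : ℕ} (hn : 3 ≤ n) : 1 ≤ Real.log n := by
  have h3 : (3 : ℝ) ≤ n := by exact_mod_cast hn
  rw [Real.le_log_iff_exp_le (by linarith)]
  linarith [Real.exp_one_lt_d9]

lemma circleDefect_mem {n : ℕ} (hn : 3 ≤ n) :
    0 ≤ circleDefect n ∧ circleDefect n ≤ Real.log n := by
  have h := abs_le.1 (abs_circleDefect_sub_le (by omega : 2 ≤ n))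
  have hlog := one_le_log_natCast hn
  have h3 : (3 : ℝ) ≤ n := by exact_mod_cast hn
  have h3n : (3 : ℝ) / n ≤ 1 := (div_le_one (by linarith)).2 h3
  have hg1 := Real.one_half_lt_eulerMascheroniConstant
  have hg2 := Real.eulerMascheroniConstant_lt_two_thirds
  have hpi : 9 < Real.pi ^ 2 := by nlinarith [Real.pi_gt_three]
  constructor
  · by_contra hneg
    push Not at hneg
    nlinarith [h.1]
  · by_contra hgt
    push Not at hgt
    nlinarith [h.2]

lemma log_le_half {x : ℝ} (hx : 0 < x) : Real.log x ≤ x / 2 := by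
  have h := Real.log_le_sub_one_of_pos (Real.sqrt_pos.2 hx)
  rw [Real.log_sqrt hx.le] at h
  nlinarith [Real.sq_sqrt hx.le, sq_nonneg (√x - 2)]

/-- A quantitative form of `(1 - s)^d = 1 - d s + O(s²)`. -/
lemma abs_one_sub_pow_sub_le {s : ℝ} (h0 : 0 ≤ s) (h1 : s ≤ 1) (d : ℕ) :
    |1 - (1 - s) ^ d - d * s| ≤ (d : ℝ) ^ 2 * s ^ 2 := by
  have hlow : 1 - d * s ≤ (1 - s) ^ d := by
    have := one_add_mul_le_pow (a := -s) (by linarith) d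
    rw [← sub_eq_add_neg] at this
    linarith
  have hup : (1 - s) ^ d ≤ 1 - d * s + (d : ℝ) ^ 2 * s ^ 2 := by
    induction d with
    | zero => simp
    | succ d ih =>
      have ih' := ih (by
        have := one_add_mul_le_pow (a := -s) (by linarith) d
        rw [← sub_eq_add_neg] at this
        linarith)
      have hd : (0 : ℝ) ≤ d := d.cast_nonneg
      have h2 : 0 ≤ (d : ℝ) ^ 2 * s ^ 3 := by positivity
      have h3 : 0 ≤ ((d : ℝ) + 1) * s ^ 2 := by positivity
      rw [pow_succ]
      push_cast
      nlinarith [mul_le_mul_of_nonneg_right ih' (sub_nonneg.2 h1)]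
  rw [abs_le]
  constructor
  · linarith
  · have : 0 ≤ (d : ℝ) ^ 2 * s ^ 2 := by positivity
    linarith

lemma pow_rpow_one_add_div {n d : ℕ} (hd : 1 ≤ d) (j : ℕ) :
    (((n ^ d : ℕ) : ℝ)) ^ (1 + (j : ℝ) / (d : ℝ)) = (n : ℝ) ^ (d + j) := by
  have hd' : (d : ℝ) ≠ 0 := by positivity
  push_cast
  rw [← Real.rpow_natCast, ← Real.rpow_mul n.cast_nonneg, ← Real.rpow_natCast]
  congr 1
  push_cast
  field_simp

/-- The exact mean square discrepancy of the harmonic ensemble with `n = 2T + 1`, `N = n ^ d`. -/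
def meanDiscrepancySq (d n : ℕ) : ℝ :=
  (((n : ℝ) / 2) ^ d - circlePairIntegral n ^ d) / ((n ^ d : ℕ) : ℝ) ^ 2

lemma abs_meanDiscrepancySq_sub_le {d n : ℕ} (hd : 1 ≤ d) (hn : 3 ≤ n) :
    |meanDiscrepancySq d n
        - (Real.log n + Real.eulerMascheroniConstant + 1) * d
          / (2 ^ (d - 1) * Real.pi ^ 2 * (n : ℝ) ^ (d + 1))|
      ≤ 5 * (d * Real.log n) ^ 2 / (n : ℝ) ^ (d + 2) := by
  have h3 : (3 : ℝ) ≤ n := by exact_mod_cast hn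
  have hn0 : (0 : ℝ) < n := by linarith
  have hd1 : (1 : ℝ) ≤ d := by exact_mod_cast hd
  have hlog := one_le_log_natCast hn
  have hpi : 9 < Real.pi ^ 2 := by nlinarith [Real.pi_gt_three]
  have hpi0 : (0 : ℝ) < Real.pi ^ 2 := by linarith
  obtain ⟨hI0, hI1⟩ := circleDefect_mem hn
  have hIn := hI1.trans (log_le_half hn0)
  have hdef := abs_circleDefect_sub_le (by omega : 2 ≤ n)
  set L := Real.log n
  set G := L + Real.eulerMascheroniConstant + 1
  set I := circleDefect n with hI
  -- With this `s`, `circlePairIntegral n = (n / 2) (1 - s)`, and the discrepancy is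
  -- `2⁻ᵈ n⁻ᵈ (1 - (1 - s)^d)`.
  set s : ℝ := 2 * I / n with hs
  have hs0 : 0 ≤ s := by positivity
  have hs1 : s ≤ 1 := (div_le_one hn0).2 (by linarith)
  have hJ : circlePairIntegral n = (n : ℝ) / 2 * (1 - s) := by
    rw [hs, hI, circleDefect]
    field_simp
    ring
  set A : ℝ := 1 / (2 ^ d * (n : ℝ) ^ d) with hA
  have hA0 : 0 ≤ A := by positivity
  have hA1 : A ≤ 1 / (n : ℝ) ^ d := by
    rw [hA]
    refine one_div_le_one_div_of_le (by positivity) ?_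
    exact le_mul_of_one_le_left (by positivity) (one_le_pow₀ (by norm_num))
  have hE : meanDiscrepancySq d n = A * (1 - (1 - s) ^ d) := by
    rw [meanDiscrepancySq, hJ, mul_pow, div_pow, hA]
    push_cast
    field_simp
  have h2d : (2 : ℝ) ^ d = 2 * 2 ^ (d - 1) := by
    rw [← pow_succ', Nat.sub_add_cancel hd]
  have hM : G * d / (2 ^ (d - 1) * Real.pi ^ 2 * (n : ℝ) ^ (d + 1))
      = A * (d * s) - A * (2 * d / (n * Real.pi ^ 2)) * (Real.pi ^ 2 * I - G) := by
    rw [hA, hs, h2d, pow_succ]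
    field_simp
    ring
  have hsplit : meanDiscrepancySq d n
      - G * d / (2 ^ (d - 1) * Real.pi ^ 2 * (n : ℝ) ^ (d + 1))
      = A * ((1 - (1 - s) ^ d - d * s) + 2 * d / (n * Real.pi ^ 2) * (Real.pi ^ 2 * I - G)) := by
    rw [hE, hM]
    ring
  have hb1 : |1 - (1 - s) ^ d - d * s| ≤ 4 * (d * L) ^ 2 / (n : ℝ) ^ 2 := by
    refine (abs_one_sub_pow_sub_le hs0 hs1 d).trans ?_
    have : (d : ℝ) ^ 2 * s ^ 2 = 4 * (d * I) ^ 2 / (n : ℝ) ^ 2 := by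
      rw [hs]
      ring
    rw [this]
    gcongr
  have hb2 : |2 * d / (n * Real.pi ^ 2) * (Real.pi ^ 2 * I - G)| ≤ (d * L) ^ 2 / (n : ℝ) ^ 2 := by
    rw [abs_mul, abs_of_nonneg (by positivity : 0 ≤ 2 * (d : ℝ) / (n * Real.pi ^ 2))]
    refine (mul_le_mul_of_nonneg_left hdef (by positivity)).trans ?_
    have h6 : 2 * (d : ℝ) / (n * Real.pi ^ 2) * (3 / n) = (6 / Real.pi ^ 2 * d) / (n : ℝ) ^ 2 := by
      field_simp
      ring
    rw [h6]
    have h7 : 6 / Real.pi ^ 2 ≤ 1 := (div_le_one hpi0).2 (by linarith)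
    have hdL : (d : ℝ) ≤ d * L := le_mul_of_one_le_right (by linarith) hlog
    gcongr
    nlinarith
  rw [hsplit, abs_mul, abs_of_nonneg hA0]
  calc A * |(1 - (1 - s) ^ d - d * s) + 2 * d / (n * Real.pi ^ 2) * (Real.pi ^ 2 * I - G)|
      ≤ 1 / (n : ℝ) ^ d * (4 * (d * L) ^ 2 / (n : ℝ) ^ 2 + (d * L) ^ 2 / (n : ℝ) ^ 2) := by
        refine mul_le_mul hA1 ((abs_add_le _ _).trans (add_le_add hb1 hb2)) (abs_nonneg _)
          (by positivity)
    _ = 5 * (d * L) ^ 2 / (n : ℝ) ^ (d + 2) := by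
        rw [pow_add]
        field_simp
        ring

/-- The main term of the mean square discrepancy, `log N / (2^(d-1) π² N^(1+1/d))` for `N = n ^ d`. -/
def mainTerm (d n : ℕ) : ℝ :=
  d * Real.log n / (2 ^ (d - 1) * Real.pi ^ 2 * (n : ℝ) ^ (d + 1))

lemma tendsto_meanDiscrepancySq_div_mainTerm {d : ℕ} (hd : 1 ≤ d) :
    Tendsto (fun n : ℕ => meanDiscrepancySq d n / mainTerm d n) atTop (nhds 1) := by
  have hlog : Tendsto (fun n : ℕ => Real.log n) atTop atTop :=
    Real.tendsto_log_atTop.comp tendsto_natCast_atTop_atTop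
  have h1 : Tendsto (fun n : ℕ => (Real.eulerMascheroniConstant + 1) / Real.log n) atTop
      (nhds 0) := tendsto_const_nhds.div_atTop hlog
  have h2 : Tendsto (fun n : ℕ => (5 * d * 2 ^ (d - 1) * Real.pi ^ 2) * (Real.log n / n)) atTop
      (nhds 0) := by
    have := (Real.isLittleO_log_id_atTop.tendsto_div_nhds_zero.comp
      (tendsto_natCast_atTop_atTop (R := ℝ))).const_mul (5 * d * 2 ^ (d - 1) * Real.pi ^ 2 : ℝ)
    rwa [mul_zero] at this
  have h12 := h1.add h2
  rw [add_zero] at h12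
  rw [tendsto_iff_norm_sub_tendsto_zero]
  refine squeeze_zero' (Eventually.of_forall fun n => norm_nonneg _) ?_ h12
  filter_upwards [eventually_ge_atTop 3] with n hn
  have hb := abs_meanDiscrepancySq_sub_le hd hn
  have hlog1 := one_le_log_natCast hn
  have h3 : (3 : ℝ) ≤ n := by exact_mod_cast hn
  have hn0 : (0 : ℝ) < n := by linarith
  have hd0 : (0 : ℝ) < d := by exact_mod_cast hd
  have hg := Real.one_half_lt_eulerMascheroniConstant
  have hL0 : 0 < Real.log n := by linarith
  have hpi := Real.pi_pos
  have hR : 0 < mainTerm d n := by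
    unfold mainTerm
    positivity
  set γ := Real.eulerMascheroniConstant
  set L := Real.log n with hL
  have hM : (L + γ + 1) * d / (2 ^ (d - 1) * Real.pi ^ 2 * (n : ℝ) ^ (d + 1))
      = mainTerm d n * (1 + (γ + 1) / L) := by
    rw [mainTerm, ← hL]
    field_simp
    ring
  have herr : 5 * (d * L) ^ 2 / (n : ℝ) ^ (d + 2)
      = mainTerm d n * (5 * d * 2 ^ (d - 1) * Real.pi ^ 2 * (L / n)) := by
    rw [mainTerm, ← hL, pow_add, pow_add]
    field_simp
  rw [hM, herr] at hb
  have hdiv : meanDiscrepancySq d n / mainTerm d n - 1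
      = (γ + 1) / L + (meanDiscrepancySq d n - mainTerm d n * (1 + (γ + 1) / L)) / mainTerm d n := by
    field_simp
    ring
  rw [Real.norm_eq_abs, hdiv]
  refine (abs_add_le _ _).trans (add_le_add (abs_of_nonneg (by positivity)).le ?_)
  rw [abs_div, abs_of_pos hR, div_le_iff₀ hR, mul_comm _ (mainTerm d n)]
  exact hb

lemma sqrt_mainTerm {d n : ℕ} (hd : 1 ≤ d) (hn : 1 ≤ n) :
    √(mainTerm d n) = 1 / ((2 : ℝ) ^ (((d : ℝ) - 1) / 2) * Real.pi)
      * ((Real.log ((n ^ d : ℕ) : ℝ)) ^ (1 / 2 : ℝ)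
        / ((n ^ d : ℕ) : ℝ) ^ (1 / 2 + 1 / (2 * (d : ℝ)))) := by
  have hd' : (d : ℝ) ≠ 0 := by positivity
  have hn1 : (1 : ℝ) ≤ n := by exact_mod_cast hn
  have hlogN : 0 ≤ Real.log ((n ^ d : ℕ) : ℝ) := Real.log_natCast_nonneg _
  refine (Real.sqrt_eq_iff_mul_self_eq ?_ ?_).2 ?_
  · unfold mainTerm
    have := Real.log_nonneg hn1
    positivity
  · positivity
  · have e1 : ((2 : ℝ) ^ (((d : ℝ) - 1) / 2)) ^ 2 = 2 ^ (d - 1) := by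
      rw [← Real.rpow_natCast, ← Real.rpow_mul zero_le_two, ← Real.rpow_natCast, Nat.cast_sub hd]
      congr 1
      push_cast
      ring
    have e2 : ((Real.log ((n ^ d : ℕ) : ℝ)) ^ (1 / 2 : ℝ)) ^ 2 = d * Real.log n := by
      rw [← Real.sqrt_eq_rpow, Real.sq_sqrt hlogN, Nat.cast_pow, Real.log_pow]
    have e3 : (((n ^ d : ℕ) : ℝ) ^ (1 / 2 + 1 / (2 * (d : ℝ)))) ^ 2 = (n : ℝ) ^ (d + 1) := by
      rw [← pow_rpow_one_add_div hd 1, ← Real.rpow_natCast, ← Real.rpow_mul (Nat.cast_nonneg _)]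
      congr 1
      push_cast
      field_simp
    rw [← sq, mul_pow, div_pow, div_pow, mul_pow, e1, e2, e3, mainTerm]
    ring

end TorusHarmonic
end

theorem theorem3 (d : ℕ) (hd : 1 ≤ d) :
    (∃ C : ℝ, ∀ (T N : ℕ), 1 ≤ T → N = (2 * T + 1) ^ d →
      ∀ (Ω : Type*) [MeasurableSpace Ω] (P : Measure Ω) [IsProbabilityMeasure P]
        (X : Ω → Finset (TorusHarmonic.Torus d)), TorusHarmonic.IsHarmonicEnsemble d T P X →
        Integrable (fun ω => TorusHarmonic.periodicDiscrepancy (X ω) ^ 2) P ∧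
        |(∫ ω, TorusHarmonic.periodicDiscrepancy (X ω) ^ 2 ∂P)
          - (Real.log N + (Real.eulerMascheroniConstant + 1) * d)
              / (2 ^ (d - 1) * Real.pi ^ 2 * (N : ℝ) ^ (1 + 1 / (d : ℝ)))|
          ≤ C * ((Real.log N) ^ 2 / (N : ℝ) ^ (1 + 2 / (d : ℝ)))) ∧
    (∀ (N : ℕ → ℕ), (∀ T, N T = (2 * T + 1) ^ d) →
      ∀ (Ω : ℕ → Type*) [∀ T, MeasurableSpace (Ω T)] (P : ∀ T, Measure (Ω T))
        [∀ T, IsProbabilityMeasure (P T)] (X : ∀ T, Ω T → Finset (TorusHarmonic.Torus d)),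
        (∀ T, 1 ≤ T → TorusHarmonic.IsHarmonicEnsemble d T (P T) (X T)) →
        (fun T => √(∫ ω, TorusHarmonic.periodicDiscrepancy (X T ω) ^ 2 ∂(P T)))
          ~[atTop] fun T =>
            1 / ((2 : ℝ) ^ (((d : ℝ) - 1) / 2) * Real.pi)
              * ((Real.log (N T)) ^ (1 / 2 : ℝ)
                / (N T : ℝ) ^ (1 / 2 + 1 / (2 * (d : ℝ))))) := by
  refine ⟨⟨5, ?_⟩, ?_⟩
  · intro T N hT hN Ω _ P _ X hX
    obtain ⟨hi, he⟩ := hX.integral_discrepancy_sq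
    refine ⟨hi, ?_⟩
    have h := TorusHarmonic.abs_meanDiscrepancySq_sub_le hd (by omega : 3 ≤ 2 * T + 1)
    rw [TorusHarmonic.meanDiscrepancySq, ← he] at h
    have e1 := TorusHarmonic.pow_rpow_one_add_div (n := 2 * T + 1) hd 1
    have e2 := TorusHarmonic.pow_rpow_one_add_div (n := 2 * T + 1) hd 2
    have elog : Real.log (((2 * T + 1) ^ d : ℕ) : ℝ) = d * Real.log ((2 * T + 1 : ℕ) : ℝ) := by
      rw [Nat.cast_pow, Real.log_pow]
    rw [Nat.cast_one] at e1
    rw [Nat.cast_two] at e2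
    rw [hN, e1, e2, elog, ← mul_div_assoc]
    convert h using 5
    ring
  · intro N hN Ω _ P _ X hX
    have hn : Tendsto (fun T : ℕ => 2 * T + 1) atTop atTop :=
      tendsto_atTop_mono (fun T => by simp only [id]; omega) tendsto_id
    have hsqrt := ((TorusHarmonic.tendsto_meanDiscrepancySq_div_mainTerm hd).comp hn).sqrt
    rw [Real.sqrt_one] at hsqrt
    refine IsEquivalent.congr_right (v := fun T => √(TorusHarmonic.mainTerm d (2 * T + 1))) ?_
      (Eventually.of_forall fun T => ?_)
    · refine isEquivalent_of_tendsto_one (hsqrt.congr' ?_)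
      filter_upwards [eventually_ge_atTop 1] with T hT
      have he := (hX T hT).integral_discrepancy_sq.2
      have hpos : 0 ≤ TorusHarmonic.mainTerm d (2 * T + 1) := by
        unfold TorusHarmonic.mainTerm
        have := Real.log_natCast_nonneg (2 * T + 1)
        positivity
      rw [Function.comp_apply, Real.sqrt_div' _ hpos, Pi.div_apply, he]
      rfl
    · simp only [hN T]
      exact TorusHarmonic.sqrt_mainTerm hd (by omega)
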